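/- **Setup.** Let $V$ be a finite set, let $K\colon V^2\to[0,1]$ be a sub-stochastic matrix ($\sum_{y}K(x,y)\le 1$ for all $x$) none of whose non-empty principal sub-matrices is stochastic, let $\lambda\in(0,\infty)$, and let $\nu$ be a probability distribution on $V$ such that every site is visited with positive probability by a $K$-walk started from $\nu$ (for every $y\in V$ there are $x\in V$ and $k\ge 0$ with $\nu(x)K^k(x,y)>0$). A configuration is an element of $\{0,\mathrm{s},1,2,\dots\}^V$: a site is empty ($0$), holds one sleeping particle ($\mathrm{s}$), or holds $k\ge1$ active particles ($k$). In the continuous-time activated random walk dynamics, active particles independently jump from $x$ to $y$ at rate $K(x,y)$ and are killed (removed) at rate $1-\sum_yK(x,y)$ when at $x$; an active particle that is alone on its site falls asleep at rate $\lambda$; a sleeping particle does not move, and becomes active as soon as another particle arrives at its site. The $\mathrm{ARW}(K,\lambda,\nu)$ chain is the discrete-time Markov chain on the set $\mathcal X=\{0,\mathrm s\}^V$ of stable configurations which, at each step, adds one active particle at a $\nu$-distributed random site and then runs the dynamics until it is absorbed in a stable configuration. Write $P$ for its transition matrix and $\pi$ for its invariant distribution, and set, for $t\in\mathbb N=\{0,1,2,\dots\}$,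 $$d_{\mathrm{sep}}(t)=\max_{\eta,\eta'\in\mathcal X}\Big(1-\frac{P^t(\eta,\eta')}{\pi(\eta')}\Big),\qquad d_{\mathrm{TV}}(t)=\max_{\eta\in\mathcal X,\,A\subseteq\mathcal X}\big|P^t(\eta,A)-\pi(A)\big|,$$ $$t_{\mathrm{sep}}=\min\{t\in\mathbb N: d_{\mathrm{sep}}(t)\le 1/2\},\qquad t_{\mathrm{mix}}=\min\{t\in\mathbb N: d_{\mathrm{TV}}(t)\le 1/2\}.$$ A sequence of such chains (indexed by $n$, with arbitrary $V_n,K_n,\lambda_n,\nu_n$ as above) exhibits *separation cutoff* if for every fixed $\alpha\ge0$, as $n\to\infty$, $d_{\mathrm{sep}}^{(n)}(\lfloor\alpha t_{\mathrm{sep}}^{(n)}\rfloor)\to1$ if $\alpha<1$ and $\to0$ if $\alpha>1$; it exhibits *total-variation cutoff* if the same holds with $d_{\mathrm{TV}}^{(n)},t_{\mathrm{mix}}^{(n)}$ in place of $d_{\mathrm{sep}}^{(n)},t_{\mathrm{sep}}^{(n)}$. **Corollary (total-variation cutoff implies separation cutoff).** If a sequence of $\mathrm{ARW}(K_n,\lambda_n,\nu_n)$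 chains exhibits total-variation cutoff, then it also exhibits separation cutoff. -/

import Mathlib

open Filter Topology

noncomputable section

namespace ARW

/-! ### Finite Markov chains: distance to equilibrium, mixing times, cutoff -/

section MarkovChain

variable {S : Type*} [Fintype S] [DecidableEq S]

/-- `π` is an invariant probability distribution of the transition matrix `P`. -/
def IsInvariantDistribution (P : Matrix S S ℝ) (π : S → ℝ) : Prop :=
  (∀ x, 0 ≤ π x) ∧ ∑ x, π x = 1 ∧ ∀ y, ∑ x, π x * P x y = π y

/-- The invariant distribution of `P` (it is unique when `P` is irreducible). -/
def invariantDistribution (P : Matrix S S ℝ) : S → ℝ :=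
  Classical.epsilon (IsInvariantDistribution P)

/-- Separation distance: the maximum over `x`, `y` of `1 - P ^ t (x, y) / π y`. -/
def sepDist (P : Matrix S S ℝ) (t : ℕ) : ℝ :=
  ⨆ p : S × S, (1 - (P ^ t) p.1 p.2 / invariantDistribution P p.2)

/-- Total-variation distance: the maximum over states `x` and sets `A` of states of
`|P ^ t (x, A) - π A|`. -/
def tvDist (P : Matrix S S ℝ) (t : ℕ) : ℝ :=
  ⨆ p : S × Finset S, |∑ y ∈ p.2, (P ^ t) p.1 y - ∑ y ∈ p.2, invariantDistribution P y|

end MarkovChain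

/-- The mixing time at precision `ε` associated with a distance-to-equilibrium function `d`. -/
def mixingTime (d : ℕ → ℝ) (ε : ℝ) : ℕ := sInf {t : ℕ | d t ≤ ε}

/-- Cutoff for a sequence `d n` of distance-to-equilibrium functions. -/
def HasCutoff (d : ℕ → ℕ → ℝ) : Prop :=
  ∀ α : ℝ, 0 ≤ α →
    (α < 1 → Tendsto (fun n => d n ⌊α * mixingTime (d n) (1 / 2)⌋₊) atTop (𝓝 1)) ∧
    (1 < α → Tendsto (fun n => d n ⌊α * mixingTime (d n) (1 / 2)⌋₊) atTop (𝓝 0))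

/-! ### Activated random walks -/

/-- The parameters `(K, lam, ν)` of an activated random walk on the finite set `V`. -/
structure Params (V : Type*) [Fintype V] [DecidableEq V] where
  /-- the sub-stochastic matrix governing the killed walk -/
  K : Matrix V V ℝ
  /-- the sleeping rate -/
  lam : ℝ
  /-- the law of the insertion site -/
  ν : V → ℝ
  K_nonneg : ∀ x y, 0 ≤ K x y
  K_row_le : ∀ x, ∑ y, K x y ≤ 1
  /-- no principal sub-matrix of `K` is stochastic -/
  K_nondegenerate : ∀ A : Finset V, A.Nonempty → ¬ ∀ x ∈ A, ∑ y ∈ A, K x y = 1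
  lam_pos : 0 < lam
  ν_nonneg : ∀ x, 0 ≤ ν x
  ν_sum : ∑ x, ν x = 1
  /-- every site has a positive chance of being visited by a `K`-walk started from `ν` -/
  reach : ∀ y, ∃ x, 0 < ν x ∧ ∃ k : ℕ, 0 < (K ^ k) x y

/-- The state of a site: `active k` means that there are `k` active particles and no sleeping one
(so `active 0` is an empty site); `asleep` means that there is a single, sleeping particle. -/
inductive SiteState where
  | active (k : ℕ)
  | asleep
  deriving DecidableEq

namespace SiteState

/-- The number of particles. -/
def count : SiteState → ℕ
  | active k => k
  | asleep => 1

/-- The number of active particles. -/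
def activeCount : SiteState → ℕ
  | active k => k
  | asleep => 0

/-- An active particle arrives; a sleeping particle gets activated by contact. -/
def arrive : SiteState → SiteState
  | active k => active (k + 1)
  | asleep => active 2

/-- An active particle leaves. -/
def leave : SiteState → SiteState
  | active k => active (k - 1)
  | asleep => asleep

lemma finite_count_le (N : ℕ) : {s : SiteState | s.count ≤ N}.Finite := by
  refine ((Set.finite_Iic N).image active |>.union (Set.finite_singleton asleep)).subset ?_
  rintro (k | _) h
  · exact Or.inl ⟨k, h, rfl⟩
  · exact Or.inr rfl

lemma count_arrive (s : SiteState) : s.arrive.count = s.count + 1 := by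
  cases s <;> rfl

end SiteState

variable {V : Type*} [Fintype V]

/-- The total number of particles of a configuration. -/
def numParticles (η : V → SiteState) : ℕ := ∑ x, (η x).count

/-- The configuration in which the sleeping particles sit exactly at the sites marked `true`, and
the other sites are empty. This identifies `V → Bool` with the set of stable configurations. -/
def ofStable (η : V → Bool) : V → SiteState :=
  fun x => if η x then SiteState.asleep else SiteState.active 0

lemma numParticles_ofStable_le (η : V → Bool) : numParticles (ofStable η) ≤ Fintype.card V := by
  unfold numParticles ofStable
  refine (Finset.sum_le_card_nsmul Finset.univ _ 1 ?_).trans (by simp)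
  intro x _
  cases η x <;> simp [SiteState.count]

variable [DecidableEq V]

/-- Add an active particle at `x`. -/
def addParticle (η : V → SiteState) (x : V) : V → SiteState :=
  Function.update η x (η x).arrive

/-- Remove an active particle from `x`. -/
def removeParticle (η : V → SiteState) (x : V) : V → SiteState :=
  Function.update η x (η x).leave

/-- The jump rates of the dynamics. Each of the active particles at `x` jumps to `y` at rate
`K x y` and is killed at rate `1 - ∑ y, K x y`; it falls asleep at rate `lam` when alone on its
site. -/
def rate (a : Params V) (η ξ : V → SiteState) : ℝ :=
  ∑ x, (((η x).activeCount : ℝ) *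
      ((∑ y, if ξ = addParticle (removeParticle η x) y then a.K x y else 0) +
        (if ξ = removeParticle η x then 1 - ∑ y, a.K x y else 0)) +
    (if η x = SiteState.active 1 ∧ ξ = Function.update η x SiteState.asleep then a.lam else 0))

/-- The configurations with at most `N` particles. The dynamics never creates a particle, so it
leaves this finite set invariant. -/
def Config (V : Type*) [Fintype V] (N : ℕ) : Type _ :=
  {η : V → SiteState // numParticles η ≤ N}

instance (N : ℕ) : DecidableEq (Config V N) :=
  inferInstanceAs (DecidableEq {η : V → SiteState // numParticles η ≤ N})

instance (N : ℕ) : Finite (Config V N) := by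
  refine Set.Finite.to_subtype (s := {η : V → SiteState | numParticles η ≤ N}) ?_
  refine (Set.Finite.pi' (fun _ : V => SiteState.finite_count_le N)).subset ?_
  intro η hη x
  exact (Finset.single_le_sum (f := fun x => (η x).count) (fun _ _ => Nat.zero_le _)
    (Finset.mem_univ x)).trans hη

instance (N : ℕ) : Fintype (Config V N) := Fintype.ofFinite _

/-- The generator of the dynamics on the configurations with at most `N` particles. -/
def generator (a : Params V) (N : ℕ) : Matrix (Config V N) (Config V N) ℝ :=
  Matrix.of (fun η ξ => rate a η.1 ξ.1) - Matrix.diagonal (fun η => ∑ ξ : Config V N, rate a η.1 ξ.1)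

/-- The probability that the continuous-time dynamics started from `η` is in `ξ` at time `t`. -/
def transitionProb (a : Params V) (N : ℕ) (t : ℝ) (η ξ : Config V N) : ℝ :=
  NormedSpace.exp (t • generator a N) η ξ

/-- The probability that the dynamics started from `η` is eventually absorbed in the stable
configuration `ξ`. -/
def stabilizationProb (a : Params V) (N : ℕ) (η ξ : Config V N) : ℝ :=
  limUnder atTop (fun t : ℝ => transitionProb a N t η ξ)

lemma numParticles_addParticle (η : V → SiteState) (x : V) :
    numParticles (addParticle η x) = numParticles η + 1 := by
  unfold numParticles addParticle
  rw [← Finset.add_sum_erase _ _ (Finset.mem_univ x),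
    ← Finset.add_sum_erase _ (fun y => (η y).count) (Finset.mem_univ x)]
  have h : ∑ y ∈ Finset.univ.erase x, (Function.update η x (η x).arrive y).count =
      ∑ y ∈ Finset.univ.erase x, (η y).count :=
    Finset.sum_congr rfl fun y hy => by rw [Function.update_of_ne (Finset.ne_of_mem_erase hy)]
  rw [h, Function.update_self, SiteState.count_arrive]
  omega

/-- A stable configuration, among the configurations with at most `|V| + 1` particles. -/
def stableConfig (η : V → Bool) : Config V (Fintype.card V + 1) :=
  ⟨ofStable η, (numParticles_ofStable_le η).trans (Nat.le_succ _)⟩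

/-- A stable configuration to which one active particle has been added at `x`. -/
def insertedConfig (η : V → Bool) (x : V) : Config V (Fintype.card V + 1) :=
  ⟨addParticle (ofStable η) x, by
    rw [numParticles_addParticle]; exact Nat.succ_le_succ (numParticles_ofStable_le η)⟩

/-- The transition matrix of the activated random walk chain on stable configurations: add an
active particle at a `ν`-distributed site, then stabilize. -/
def chain (a : Params V) : Matrix (V → Bool) (V → Bool) ℝ :=
  Matrix.of fun η ξ =>
    ∑ x, a.ν x * stabilizationProb a (Fintype.card V + 1) (insertedConfig η x) (stableConfig ξ)

end ARW

end

/-!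
# Total-variation cutoff implies separation cutoff for activated random walks

The proof compares the chain with internal DLA: walks are started one after the other from `ν`, and
each of them is stopped at the first site outside the current aggregate, which it then joins, unless
it is killed before. Let `T` be the number of walks needed to fill `V`.

*Abelian property.* The probability `stab η ξ` that legal topplings transform `η` into the stable
configuration `ξ` does not depend on the order of the topplings (`stabWithin_succ`), because
topplings at different active sites commute. As a function of `η` it is invariant under every legal
toppling, hence harmonic for the continuous-time dynamics. A Lyapunov function (`unstable_mass_le`)
shows that harmonic functions are determined by their values on stable configurations, so that
`stab` is the absorption probability of the dynamics (`stabilizationProb_eq`).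

*Separation distance.* Stabilization may thus be postponed, and newly inserted particles may first
be moved according to internal DLA. Once they fill `V`, all the remaining particles may be walked to
their death, so the outcome is distributed as the stabilization of one active particle per site,
which is the invariant distribution; conversely the full configuration cannot be reached from the
empty one before time `T`. Hence the separation distance at time `t` is exactly the probability that
`T > t` (`sepDist_chain`).

*Concentration.* Let `gap` be the smallest probability that a walk started from `ν` visits a given
site. An additional occupied site lowers the expected filling time by at most `1 / gap`
(`fillTime_insert`), while one walk lowers it by `1` on average. Therefore the variance of `T` is at
most its mean divided by `gap`, and separation cutoff follows from Chebyshev's inequality as soon as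
`gap * sepTime` tends to infinity.

*Spectral bound.* If `y` is the site which is hardest to visit, then the law of the stabilization of
one active particle at each site but `y`, minus the invariant distribution, is a left eigenvector of
the chain with eigenvalue `1 - gap` (`exists_eigenvector`). Hence `(1 - gap) ^ t` is at most twice
the total-variation distance, and total-variation cutoff forces `(1 - gap) ^ (2 * sepTime)` to vanish.
This makes `gap * sepTime` large, except possibly along indices where `sepTime * (1 - gap)` is small
(`exists_forall_le_or_le`); for these `T` equals the number of sites with high probability, and the
separation distance drops abruptly from `1` to almost `0` at that time.
-/

namespace ARW

noncomputable section

set_option linter.unusedSectionVars false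

variable {V : Type*} [Fintype V] [DecidableEq V] (a : Params V)

/-! ### Walks killed inside a set of sites -/

/-- The matrix of the walk which is stopped upon leaving `A`: the rows of `K` outside `A` are
replaced by zero. -/
def Params.restrict (a : Params V) (A : Finset V) : Matrix V V ℝ :=
  Matrix.of fun x y => if x ∈ A then a.K x y else 0

/-- The probability that the walk stopped upon leaving `A` makes no further step from `x`. It is
the killing probability at `x` if `x ∈ A`, and `1` otherwise. -/
def Params.stopProb (a : Params V) (A : Finset V) (x : V) : ℝ :=
  1 - ∑ y, a.restrict A x y

variable (a : Params V)

lemma restrict_of_mem {A : Finset V} {x : V} (hx : x ∈ A) (y : V) :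
    a.restrict A x y = a.K x y := by
  simp [Params.restrict, hx]

lemma restrict_of_notMem {A : Finset V} {x : V} (hx : x ∉ A) (y : V) :
    a.restrict A x y = 0 := by
  simp [Params.restrict, hx]

lemma restrict_nonneg (A : Finset V) (x y : V) : 0 ≤ a.restrict A x y := by
  unfold Params.restrict
  simp only [Matrix.of_apply]
  split_ifs
  exacts [a.K_nonneg x y, le_rfl]

lemma stopProb_nonneg (A : Finset V) (x : V) : 0 ≤ a.stopProb A x := by
  unfold Params.stopProb
  by_cases hx : x ∈ A
  · simp only [restrict_of_mem a hx]
    linarith [a.K_row_le x]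
  · simp [restrict_of_notMem a hx]

lemma stopProb_of_mem {A : Finset V} {x : V} (hx : x ∈ A) :
    a.stopProb A x = 1 - ∑ y, a.K x y := by
  simp [Params.stopProb, restrict_of_mem a hx]

lemma stopProb_of_notMem {A : Finset V} {x : V} (hx : x ∉ A) : a.stopProb A x = 1 := by
  simp [Params.stopProb, restrict_of_notMem a hx]

/-- Minimum principle: a function which is superharmonic for the stopped walk is nonnegative. The
set where a negative minimum is attained would carry a stochastic principal sub-matrix. -/
lemma nonneg_of_superharmonic (A : Finset V) {w : V → ℝ}
    (hw : ∀ x, ∑ y, a.restrict A x y * w y ≤ w x) (x : V) : 0 ≤ w x := by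
  by_contra! hx
  obtain ⟨m, -, hm⟩ := Finset.exists_min_image Finset.univ w ⟨x, Finset.mem_univ x⟩
  have hm0 : w m < 0 := (hm x (Finset.mem_univ x)).trans_lt hx
  refine a.K_nondegenerate (Finset.univ.filter fun z => w z = w m) ⟨m, by simp⟩ fun z hz => ?_
  replace hz : w z = w m := (Finset.mem_filter.1 hz).2
  have hle : ∀ y, a.restrict A z y * w m ≤ a.restrict A z y * w y := fun y =>
    mul_le_mul_of_nonneg_left (hm y (Finset.mem_univ y)) (restrict_nonneg a A z y)
  have hsum : ∑ y, a.restrict A z y * w m ≤ w m :=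
    (Finset.sum_le_sum fun y _ => hle y).trans ((hw z).trans hz.le)
  rw [← Finset.sum_mul] at hsum
  have hzA : z ∈ A := by
    by_contra hzA
    simp only [restrict_of_notMem a hzA, Finset.sum_const_zero, zero_mul] at hsum
    linarith
  simp only [restrict_of_mem a hzA] at hsum hle
  have hone : ∑ y, a.K z y = 1 := by
    refine le_antisymm (a.K_row_le z) ?_
    by_contra! h
    nlinarith
  have heq : ∀ y, a.K z y * w m = a.K z y * w y := by
    have h1 : ∑ y, a.K z y * w m = ∑ y, a.K z y * w y := by
      refine le_antisymm (Finset.sum_le_sum fun y _ => hle y) ?_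
      have := hw z
      simp only [restrict_of_mem a hzA] at this
      rw [← Finset.sum_mul, hone, one_mul]
      linarith
    intro y
    exact (Finset.sum_eq_sum_iff_of_le fun y _ => hle y).1 h1 y (Finset.mem_univ y)
  rw [← hone, Finset.sum_filter]
  refine Finset.sum_congr rfl fun y _ => ?_
  split_ifs with hy
  · rfl
  · have := heq y
    by_contra h0
    exact hy (mul_left_cancel₀ (Ne.symm h0) this).symm

lemma mulVec_one_sub_restrict (A : Finset V) (w : V → ℝ) (x : V) :
    ((1 - a.restrict A).mulVec w) x = w x - ∑ y, a.restrict A x y * w y := by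
  rw [Matrix.sub_mulVec, Matrix.one_mulVec, Pi.sub_apply]
  rfl

lemma isUnit_one_sub_restrict (A : Finset V) : IsUnit (1 - a.restrict A) := by
  rw [← Matrix.mulVec_injective_iff_isUnit]
  have key : ∀ w : V → ℝ, (1 - a.restrict A).mulVec w = 0 → ∀ x, 0 ≤ w x := fun w hw x =>
    nonneg_of_superharmonic a A (fun z => by
      have := congrFun hw z
      rw [mulVec_one_sub_restrict, Pi.zero_apply] at this
      linarith) x
  intro w w' hww
  have h1 : (1 - a.restrict A).mulVec (w - w') = 0 := by
    rw [Matrix.mulVec_sub, sub_eq_zero]; exact hww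
  have h2 : (1 - a.restrict A).mulVec (w' - w) = 0 := by
    rw [Matrix.mulVec_sub, sub_eq_zero]; exact hww.symm
  funext x
  have := key _ h1 x
  have := key _ h2 x
  simp only [Pi.sub_apply] at *
  linarith

/-- The Green function of the walk stopped upon leaving `A`. -/
def Params.green (a : Params V) (A : Finset V) : Matrix V V ℝ := (1 - a.restrict A)⁻¹

/-- Solution of the Poisson equation. -/
lemma eq_sum_green {A : Finset V} {w b : V → ℝ}
    (hw : ∀ x, w x = ∑ y, a.restrict A x y * w y + b x) (x : V) :
    w x = ∑ z, a.green A x z * b z := by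
  have hdet := (Matrix.isUnit_iff_isUnit_det _).1 (isUnit_one_sub_restrict a A)
  have h1 : (1 - a.restrict A).mulVec w = b := by
    funext z
    rw [mulVec_one_sub_restrict]
    linarith [hw z]
  have h2 : w = (a.green A).mulVec b := by
    rw [← h1, Matrix.mulVec_mulVec, Params.green, Matrix.nonsing_inv_mul _ hdet, Matrix.one_mulVec]
  exact congrFun h2 x

lemma sum_green_eq (A : Finset V) (b : V → ℝ) (x : V) :
    ∑ z, a.green A x z * b z =
      ∑ y, a.restrict A x y * ∑ z, a.green A y z * b z + b x := by
  have hdet := (Matrix.isUnit_iff_isUnit_det _).1 (isUnit_one_sub_restrict a A)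
  have h : (1 - a.restrict A).mulVec ((a.green A).mulVec b) = b := by
    rw [Matrix.mulVec_mulVec, Params.green, Matrix.mul_nonsing_inv _ hdet, Matrix.one_mulVec]
  have := congrFun h x
  rw [mulVec_one_sub_restrict] at this
  simp only [Matrix.mulVec, dotProduct] at this
  linarith

lemma sum_green_nonneg (A : Finset V) {b : V → ℝ} (hb : ∀ x, 0 ≤ b x) (x : V) :
    0 ≤ ∑ z, a.green A x z * b z := by
  refine nonneg_of_superharmonic a A (w := fun x => ∑ z, a.green A x z * b z) (fun x => ?_) x
  have := sum_green_eq a A b x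
  linarith [hb x]

lemma green_nonneg (A : Finset V) (x z : V) : 0 ≤ a.green A x z := by
  have := sum_green_nonneg a A (b := Pi.single z 1)
    (fun y => by by_cases h : y = z <;> simp [h]) x
  simpa [Pi.single_apply] using this

/-- The probability that `z` is the last site seen by the walk started at `x` and stopped upon
leaving `A`: the exit point if the walk leaves `A`, and the site of death if it is killed in `A`. -/
def Params.lastSite (a : Params V) (A : Finset V) (x z : V) : ℝ :=
  a.green A x z * a.stopProb A z

lemma lastSite_nonneg (A : Finset V) (x z : V) : 0 ≤ a.lastSite A x z :=
  mul_nonneg (green_nonneg a A x z) (stopProb_nonneg a A z)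

/-- Solution of the Dirichlet problem: expected value of `b` at the last site of the walk. -/
lemma eq_sum_lastSite {A : Finset V} {w b : V → ℝ}
    (hw : ∀ x, w x = ∑ y, a.restrict A x y * w y + a.stopProb A x * b x) (x : V) :
    w x = ∑ z, a.lastSite A x z * b z := by
  rw [eq_sum_green a (b := fun x => a.stopProb A x * b x) hw x]
  simp only [Params.lastSite, mul_assoc]

lemma sum_lastSite_mul_eq (A : Finset V) (b : V → ℝ) (x : V) :
    ∑ z, a.lastSite A x z * b z =
      ∑ y, a.restrict A x y * ∑ z, a.lastSite A y z * b z + a.stopProb A x * b x := by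
  have := sum_green_eq a A (fun z => a.stopProb A z * b z) x
  simpa only [Params.lastSite, mul_assoc] using this

lemma sum_lastSite (A : Finset V) (x : V) : ∑ z, a.lastSite A x z = 1 := by
  have := eq_sum_lastSite a (A := A) (w := fun _ => 1) (b := fun _ => 1)
    (fun x => by simp [Params.stopProb]) x
  simpa using this.symm

/-- The law of the last site when the walk is started from `ν`. The aggregate of internal DLA moves
from `A` to `insert z A` with probability `settle A z`; dying at `z ∈ A` leaves `A` unchanged. -/
def Params.settle (a : Params V) (A : Finset V) (z : V) : ℝ := ∑ x, a.ν x * a.lastSite A x z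

lemma settle_nonneg (A : Finset V) (z : V) : 0 ≤ a.settle A z :=
  Finset.sum_nonneg fun x _ => mul_nonneg (a.ν_nonneg x) (lastSite_nonneg a A x z)

lemma sum_settle_mul (A : Finset V) (b : V → ℝ) :
    ∑ z, a.settle A z * b z = ∑ x, a.ν x * ∑ z, a.lastSite A x z * b z := by
  simp only [Params.settle, Finset.sum_mul, Finset.mul_sum]
  rw [Finset.sum_comm]
  simp only [mul_assoc]

lemma sum_settle (A : Finset V) : ∑ z, a.settle A z = 1 := by
  have := sum_settle_mul a A (fun _ => 1)
  simpa [sum_lastSite, a.ν_sum] using this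

/-- The transition operator of internal DLA. -/
def Params.idla (a : Params V) (φ : Finset V → ℝ) (A : Finset V) : ℝ :=
  ∑ z, a.settle A z * φ (insert z A)

/-- The probability that a walk started from `ν` leaves `A` before being killed. -/
def Params.exitProb (a : Params V) (A : Finset V) : ℝ := ∑ z ∈ Aᶜ, a.settle A z

lemma sum_settle_mem (A : Finset V) : ∑ z ∈ A, a.settle A z = 1 - a.exitProb A := by
  have := Finset.sum_add_sum_compl A (fun z => a.settle A z)
  rw [sum_settle] at this
  unfold Params.exitProb
  linarith

lemma exitProb_le_one (A : Finset V) : a.exitProb A ≤ 1 := by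
  have : 0 ≤ ∑ z ∈ A, a.settle A z := Finset.sum_nonneg fun z _ => settle_nonneg a A z
  rw [sum_settle_mem] at this
  linarith

lemma sum_settle_mul_split (A : Finset V) {b : V → ℝ} {c : ℝ} (hb : ∀ z ∈ A, b z = c) :
    ∑ z, a.settle A z * b z = (1 - a.exitProb A) * c + ∑ z ∈ Aᶜ, a.settle A z * b z := by
  rw [← Finset.sum_add_sum_compl A, ← sum_settle_mem, Finset.sum_mul]
  congr 1
  exact Finset.sum_congr rfl fun z hz => by rw [hb z hz]

lemma idla_eq (A : Finset V) (φ : Finset V → ℝ) :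
    a.idla φ A = (1 - a.exitProb A) * φ A + ∑ z ∈ Aᶜ, a.settle A z * φ (insert z A) :=
  sum_settle_mul_split a A fun z hz => by rw [Finset.insert_eq_of_mem hz]

lemma idla_mono {φ ψ : Finset V → ℝ} (A : Finset V)
    (h : ∀ z, φ (insert z A) ≤ ψ (insert z A)) : a.idla φ A ≤ a.idla ψ A :=
  Finset.sum_le_sum fun z _ => mul_le_mul_of_nonneg_left (h z) (settle_nonneg a A z)

lemma idla_const (A : Finset V) (c : ℝ) : a.idla (fun _ => c) A = c := by
  simp [Params.idla, ← Finset.sum_mul, sum_settle]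

lemma idla_univ (φ : Finset V → ℝ) : a.idla φ Finset.univ = φ Finset.univ := by
  simp [Params.idla, ← Finset.sum_mul, sum_settle]

/-- Strong Markov property at the exit time of `A`, for the walk stopped upon leaving `B ⊇ A`. -/
lemma idla_eq_of_subset {A B : Finset V} (hAB : A ⊆ B) (φ : Finset V → ℝ) :
    a.idla φ B = ∑ z, a.settle A z *
      (if z ∈ A then φ B else ∑ z', a.lastSite B z z' * φ (insert z' B)) := by
  rw [Params.idla, sum_settle_mul, sum_settle_mul]
  refine Finset.sum_congr rfl fun x _ => ?_
  congr 1
  refine eq_sum_lastSite a (w := fun x => ∑ z', a.lastSite B x z' * φ (insert z' B)) (fun x => ?_) x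
  by_cases hx : x ∈ A
  · simp only [hx, if_true]
    rw [sum_lastSite_mul_eq, stopProb_of_mem a hx, stopProb_of_mem a (hAB hx),
      Finset.insert_eq_of_mem (hAB hx)]
    simp only [restrict_of_mem a hx, restrict_of_mem a (hAB hx)]
  · simp [hx, restrict_of_notMem a hx, stopProb_of_notMem a hx]

lemma exitProb_anti {A B : Finset V} (hAB : A ⊆ B) : a.exitProb B ≤ a.exitProb A := by
  have h1 := idla_eq_of_subset a hAB (fun C => if C = B then 1 else 0)
  have h2 : a.idla (fun C => if C = B then (1 : ℝ) else 0) B = 1 - a.exitProb B := by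
    rw [idla_eq]
    have : ∑ z ∈ Bᶜ, a.settle B z * (if insert z B = B then (1 : ℝ) else 0) = 0 :=
      Finset.sum_eq_zero fun z hz => by
        rw [if_neg, mul_zero]
        exact fun h => (Finset.mem_compl.1 hz) (Finset.insert_eq_self.1 h)
    rw [this]
    simp
  rw [h2, sum_settle_mul_split a A (c := 1) (fun z hz => by simp [hz])] at h1
  have h3 : 0 ≤ ∑ z ∈ Aᶜ, a.settle A z * (if z ∈ A then (if B = B then (1 : ℝ) else 0) else
      ∑ z', a.lastSite B z z' * (if insert z' B = B then (1 : ℝ) else 0)) := by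
    refine Finset.sum_nonneg fun z _ => mul_nonneg (settle_nonneg a A z) ?_
    have h4 : 0 ≤ ∑ z', a.lastSite B z z' * (if insert z' B = B then (1 : ℝ) else 0) :=
      Finset.sum_nonneg fun z' _ =>
        mul_nonneg (lastSite_nonneg a B z z') (by split_ifs <;> norm_num)
    by_cases hz : z ∈ A
    · simp [hz]
    · rwa [if_neg hz]
  linarith

lemma pow_mul_nonneg (k : ℕ) (x y : V) : 0 ≤ (a.K ^ k) x y := by
  induction k generalizing x y with
  | zero => rw [pow_zero, Matrix.one_apply]; split_ifs <;> norm_num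
  | succ k ih =>
    rw [pow_succ, Matrix.mul_apply]
    exact Finset.sum_nonneg fun z _ => mul_nonneg (ih x z) (a.K_nonneg z y)

lemma exitProb_pos {A : Finset V} (hA : A ≠ Finset.univ) : 0 < a.exitProb A := by
  obtain ⟨y, hy⟩ : ∃ y, y ∉ A := by
    by_contra! h
    exact hA (Finset.eq_univ_iff_forall.2 h)
  obtain ⟨x, hx, k, hk⟩ := a.reach y
  -- the probability to leave `A`, as a function of the starting point, is superharmonic for `K`
  set u : V → ℝ := fun x => ∑ z, a.lastSite A x z * (if z ∈ A then 0 else 1) with hu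
  have hu1 : ∀ x, u x ≤ 1 := fun x => by
    refine le_trans ?_ (sum_lastSite a A x).le
    refine Finset.sum_le_sum fun z _ => ?_
    have := lastSite_nonneg a A x z
    split_ifs <;> simp [this]
  have hu0 : ∀ x, 0 ≤ u x := fun x =>
    Finset.sum_nonneg fun z _ => mul_nonneg (lastSite_nonneg a A x z) (by split_ifs <;> norm_num)
  have huA : ∀ x, x ∉ A → u x = 1 := fun x hx => by
    simp only [hu]
    rw [sum_lastSite_mul_eq]
    simp [restrict_of_notMem a hx, stopProb_of_notMem a hx, hx]
  have hsup : ∀ x, ∑ y, a.K x y * u y ≤ u x := fun x => by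
    by_cases hx : x ∈ A
    · refine le_of_eq ?_
      simp only [hu]
      rw [sum_lastSite_mul_eq (x := x)]
      simp [hx, restrict_of_mem a hx]
    · rw [huA x hx]
      refine le_trans (Finset.sum_le_sum fun y _ => ?_) (a.K_row_le x)
      exact mul_le_of_le_one_right (a.K_nonneg x y) (hu1 y)
  have hpow : ∀ k x, ∑ y, (a.K ^ k) x y * u y ≤ u x := fun k => by
    induction k with
    | zero => intro x; simp [Matrix.one_apply]
    | succ k ih =>
      intro x
      calc ∑ y, (a.K ^ (k + 1)) x y * u y = ∑ z, (a.K ^ k) x z * ∑ y, a.K z y * u y := by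
            simp only [pow_succ, Matrix.mul_apply, Finset.sum_mul, Finset.mul_sum]
            rw [Finset.sum_comm]
            simp only [mul_assoc]
        _ ≤ ∑ z, (a.K ^ k) x z * u z :=
            Finset.sum_le_sum fun z _ => mul_le_mul_of_nonneg_left (hsup z) (pow_mul_nonneg a k x z)
        _ ≤ u x := ih x
  have hux : (a.K ^ k) x y ≤ u x := by
    refine le_trans ?_ (hpow k x)
    have := Finset.single_le_sum (f := fun y => (a.K ^ k) x y * u y)
      (fun z _ => mul_nonneg (pow_mul_nonneg a k x z) (hu0 z)) (Finset.mem_univ y)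
    simpa [huA y hy] using this
  have he : a.exitProb A = ∑ x, a.ν x * u x := by
    rw [hu, ← sum_settle_mul, sum_settle_mul_split a A (c := 0) (fun z hz => by simp [hz]),
      Params.exitProb]
    simp only [mul_zero, zero_add]
    exact Finset.sum_congr rfl fun z hz => by simp [Finset.mem_compl.1 hz]
  rw [he]
  refine lt_of_lt_of_le (mul_pos hx (hk.trans_le hux)) ?_
  exact Finset.single_le_sum (f := fun x => a.ν x * u x)
    (fun x _ => mul_nonneg (a.ν_nonneg x) (hu0 x)) (Finset.mem_univ x)

/-! ### Concentration of the filling time of internal DLA -/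

/-- The expected number of walks needed by internal DLA to fill `V`, starting from the
aggregate `A`. -/
def Params.fillTime (a : Params V) (A : Finset V) : ℝ :=
  if A = Finset.univ then 0 else
    (1 + ∑ z : {z // z ∉ A}, a.settle A z * a.fillTime (insert z.1 A)) / a.exitProb A
termination_by Aᶜ.card
decreasing_by
  refine Finset.card_lt_card (Finset.compl_ssubset_compl.2 ?_)
  exact Finset.ssubset_insert z.2

lemma fillTime_univ : a.fillTime Finset.univ = 0 := by
  rw [Params.fillTime, if_pos rfl]

lemma fillTime_eq {A : Finset V} (hA : A ≠ Finset.univ) :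
    a.fillTime A = 1 + a.idla a.fillTime A := by
  have he := (exitProb_pos a hA).ne'
  have h : a.exitProb A * a.fillTime A =
      1 + ∑ z ∈ Aᶜ, a.settle A z * a.fillTime (insert z A) := by
    rw [Params.fillTime, if_neg hA, mul_div_cancel₀ _ he]
    congr 1
    exact (Finset.sum_subtype Aᶜ (fun z => Finset.mem_compl)
      (fun z => a.settle A z * a.fillTime (insert z A))).symm
  rw [idla_eq]
  linarith

lemma erase_univ_ne_empty (a : Params V) :
    (Finset.univ : Finset (Finset V)).erase Finset.univ ≠ ∅ := by
  obtain ⟨v⟩ : Nonempty V := by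
    by_contra h
    rw [not_nonempty_iff] at h
    simpa using a.ν_sum
  intro h
  have : (∅ : Finset V) ∈ (Finset.univ : Finset (Finset V)).erase Finset.univ := by
    simp only [Finset.mem_erase, Finset.mem_univ, and_true]
    exact fun h => by simpa [← h] using Finset.mem_univ v
  simp [h] at this

/-- The smallest probability, over the sites, that a walk started from `ν` visits a given site.
Since a smaller set is easier to leave, it may be computed as a minimum over all proper subsets. The
number `1 - gap` is an eigenvalue of the chain, see `exists_eigenvector`. -/
def Params.gap (a : Params V) : ℝ :=
  ((Finset.univ : Finset (Finset V)).erase Finset.univ).inf'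
    (Finset.nonempty_iff_ne_empty.2 (erase_univ_ne_empty a)) a.exitProb

lemma gap_le {A : Finset V} (hA : A ≠ Finset.univ) : a.gap ≤ a.exitProb A :=
  Finset.inf'_le _ (by simp [hA])

lemma exists_gap_eq : ∃ y, a.exitProb {y}ᶜ = a.gap := by
  obtain ⟨A, hA, h⟩ := Finset.exists_mem_eq_inf'
    (Finset.nonempty_iff_ne_empty.2 (erase_univ_ne_empty a)) a.exitProb
  have hA : A ≠ Finset.univ := (Finset.mem_erase.1 hA).1
  obtain ⟨y, hy⟩ : ∃ y, y ∉ A := by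
    by_contra! h
    exact hA (Finset.eq_univ_iff_forall.2 h)
  refine ⟨y, le_antisymm ((exitProb_anti a ?_).trans h.ge) (gap_le a fun h => ?_)⟩
  · intro z hz
    rw [Finset.mem_compl, Finset.mem_singleton]
    rintro rfl
    exact hy hz
  · have := Finset.mem_univ y
    rw [← h] at this
    simp at this

lemma gap_pos : 0 < a.gap := by
  rw [Params.gap, Finset.lt_inf'_iff]
  exact fun A hA => exitProb_pos a (Finset.mem_erase.1 hA).1

lemma gap_le_one : a.gap ≤ 1 := by
  obtain ⟨y, hy⟩ := exists_gap_eq a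
  exact hy ▸ exitProb_le_one a _

/-- One more occupied site makes the expected filling time smaller, but by at most `1 / gap`. The
extra site behaves as a second-class particle: when the larger aggregate is full, the smaller
one misses at most one site, which is visited by each new walk with probability at least `gap`. -/
lemma fillTime_insert (A : Finset V) (y : V) :
    a.fillTime (insert y A) ≤ a.fillTime A ∧
      a.fillTime A - a.fillTime (insert y A) ≤ 1 / a.gap := by
  have hgap : 0 < 1 / a.gap := one_div_pos.2 (gap_pos a)
  induction hn : Aᶜ.card using Nat.strong_induction_on generalizing A y with
  | _ n ih =>
  have ih' : ∀ B, A ⊂ B → ∀ y, a.fillTime (insert y B) ≤ a.fillTime B ∧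
      a.fillTime B - a.fillTime (insert y B) ≤ 1 / a.gap := fun B hB y =>
    ih Bᶜ.card (hn ▸ Finset.card_lt_card (Finset.compl_ssubset_compl.2 hB)) B y rfl
  by_cases hy : y ∈ A
  · rw [Finset.insert_eq_of_mem hy]
    exact ⟨le_rfl, by simpa using hgap.le⟩
  have hA : A ≠ Finset.univ := fun h => hy (h ▸ Finset.mem_univ y)
  have he := exitProb_pos a hA
  have hsub : A ⊂ insert y A := Finset.ssubset_insert hy
  by_cases hB : insert y A = Finset.univ
  · have h0 : ∑ z ∈ Aᶜ, a.settle A z * a.fillTime (insert z A) = 0 := by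
      refine Finset.sum_eq_zero fun z hz => ?_
      have : z = y := by
        have h1 := Finset.mem_univ z
        rw [← hB, Finset.mem_insert] at h1
        exact h1.resolve_right (Finset.mem_compl.1 hz)
      rw [this, hB, fillTime_univ, mul_zero]
    have h1 := fillTime_eq a hA
    rw [idla_eq, h0] at h1
    have h2 : a.fillTime A = 1 / a.exitProb A := by
      rw [eq_div_iff he.ne']
      linarith
    rw [hB, fillTime_univ, h2, sub_zero]
    exact ⟨(one_div_pos.2 he).le, one_div_le_one_div_of_le (gap_pos a) (gap_le a hA)⟩
  -- the decrease `D` is an average of the decreases from larger aggregates and of itself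
  · set D := a.fillTime A - a.fillTime (insert y A) with hD
    have hbd : ∀ z ∈ Aᶜ, 0 ≤ a.fillTime (insert z A) - (if z ∈ A then a.fillTime (insert y A) else
          ∑ z', a.lastSite (insert y A) z z' * a.fillTime (insert z' (insert y A))) ∧
        a.fillTime (insert z A) - (if z ∈ A then a.fillTime (insert y A) else
          ∑ z', a.lastSite (insert y A) z z' * a.fillTime (insert z' (insert y A))) ≤
          1 / a.gap := by
      intro z hz
      rw [Finset.mem_compl] at hz
      rw [if_neg hz]
      by_cases hzy : z = y
      · subst hzy
        have h1 : a.fillTime (insert z A) = ∑ z', a.lastSite (insert z A) z z' *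
            a.fillTime (insert z A) := by rw [← Finset.sum_mul, sum_lastSite, one_mul]
        have h2 : 1 / a.gap = ∑ z', a.lastSite (insert z A) z z' * (1 / a.gap) := by
          rw [← Finset.sum_mul, sum_lastSite, one_mul]
        constructor
        · rw [sub_nonneg, h1]
          exact Finset.sum_le_sum fun z' _ => mul_le_mul_of_nonneg_left (ih' _ hsub z').1
            (lastSite_nonneg a _ _ _)
        · nth_rw 1 [h1]
          rw [h2, ← Finset.sum_sub_distrib]
          refine Finset.sum_le_sum fun z' _ => ?_
          rw [← mul_sub]
          exact mul_le_mul_of_nonneg_left (ih' _ hsub z').2 (lastSite_nonneg a _ _ _)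
      · have hz' : z ∉ insert y A := by simp [hzy, hz]
        rw [sum_lastSite_mul_eq, stopProb_of_notMem a hz']
        simp only [restrict_of_notMem a hz', zero_mul, Finset.sum_const_zero, zero_add, one_mul]
        rw [Finset.insert_comm]
        have := ih' (insert z A) (Finset.ssubset_insert hz) y
        exact ⟨sub_nonneg.2 this.1, this.2⟩
    have h1 := fillTime_eq a hA
    have h2 := fillTime_eq a hB
    rw [idla_eq_of_subset a hsub.subset, sum_settle_mul_split a A
      (c := a.fillTime (insert y A)) (fun z hz => by simp [hz])] at h2
    rw [idla_eq] at h1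
    have h3 : a.exitProb A * D = ∑ z ∈ Aᶜ, a.settle A z *
        (a.fillTime (insert z A) - (if z ∈ A then a.fillTime (insert y A) else
          ∑ z', a.lastSite (insert y A) z z' * a.fillTime (insert z' (insert y A)))) := by
      simp only [mul_sub, Finset.sum_sub_distrib]
      rw [hD]
      linarith
    have h4 : 0 ≤ a.exitProb A * D := by
      rw [h3]
      exact Finset.sum_nonneg fun z hz => mul_nonneg (settle_nonneg a A z) (hbd z hz).1
    have h5 : a.exitProb A * D ≤ a.exitProb A * (1 / a.gap) := by
      rw [h3, Params.exitProb, Finset.sum_mul]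
      exact Finset.sum_le_sum fun z hz =>
        mul_le_mul_of_nonneg_left (hbd z hz).2 (settle_nonneg a A z)
    refine ⟨?_, le_of_mul_le_mul_left h5 he⟩
    have := (mul_nonneg_iff_of_pos_left he).1 h4
    linarith

lemma fillTime_nonneg (A : Finset V) : 0 ≤ a.fillTime A := by
  have h : ∀ B, a.fillTime (B ∪ A) ≤ a.fillTime A := fun B => by
    induction B using Finset.induction_on with
    | empty => simp
    | insert y B _ ih =>
      rw [Finset.insert_union]
      exact (fillTime_insert a _ y).1.trans ih
  have := h Finset.univ
  rwa [Finset.union_eq_left.2 (Finset.subset_univ A), fillTime_univ] at this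

/-- A quadratic function dominating the second moment of `c` plus the filling time. -/
def Params.quad (a : Params V) (c : ℝ) (A : Finset V) : ℝ :=
  (a.fillTime A + c) ^ 2 + a.fillTime A / a.gap

lemma quad_nonneg (c : ℝ) (A : Finset V) : 0 ≤ a.quad c A :=
  add_nonneg (sq_nonneg _) (div_nonneg (fillTime_nonneg a A) (gap_pos a).le)

/-- The conditional variance of one step is at most `1 / gap`, since the expected filling time
decreases by an amount in `[0, 1 / gap]` whose mean is `1`. -/
lemma idla_quad_le {A : Finset V} (hA : A ≠ Finset.univ) (c : ℝ) :
    a.idla (a.quad (c + 1)) A ≤ a.quad c A := by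
  set h := a.fillTime A with hh
  set d : V → ℝ := fun z => h - a.fillTime (insert z A) with hd
  have hd0 : ∀ z, 0 ≤ d z := fun z => sub_nonneg.2 (fillTime_insert a A z).1
  have hd1 : ∀ z, d z ≤ 1 / a.gap := fun z => (fillTime_insert a A z).2
  have hmean : ∑ z, a.settle A z * d z = 1 := by
    have := fillTime_eq a hA
    rw [Params.idla] at this
    simp only [hd, mul_sub, Finset.sum_sub_distrib, ← Finset.sum_mul, sum_settle]
    linarith
  have hsq : ∑ z, a.settle A z * d z ^ 2 ≤ 1 / a.gap := by
    calc ∑ z, a.settle A z * d z ^ 2 ≤ ∑ z, (a.settle A z * d z) * (1 / a.gap) := by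
          refine Finset.sum_le_sum fun z _ => ?_
          rw [sq, ← mul_assoc]
          exact mul_le_mul_of_nonneg_left (hd1 z) (mul_nonneg (settle_nonneg a A z) (hd0 z))
      _ = 1 / a.gap := by rw [← Finset.sum_mul, hmean, one_mul]
  have key : a.idla (a.quad (c + 1)) A =
      ∑ z, a.settle A z * ((h + c + 1) ^ 2 + h / a.gap) -
        (2 * (h + c + 1) + 1 / a.gap) * ∑ z, a.settle A z * d z +
        ∑ z, a.settle A z * d z ^ 2 := by
    rw [Finset.mul_sum, ← Finset.sum_sub_distrib, ← Finset.sum_add_distrib]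
    refine Finset.sum_congr rfl fun z _ => ?_
    simp only [Params.quad, hd]
    ring
  rw [key, ← Finset.sum_mul, sum_settle, hmean, Params.quad, ← hh]
  nlinarith [sq_nonneg (h + c)]

/-- The probability that internal DLA, started from the aggregate `A`, has not filled `V` after `n`
walks. -/
def Params.unfilled (a : Params V) : ℕ → Finset V → ℝ
  | 0, A => if A = Finset.univ then 0 else 1
  | n + 1, A => a.idla (a.unfilled n) A

lemma unfilled_univ (n : ℕ) : a.unfilled n Finset.univ = 0 := by
  induction n with
  | zero => simp [Params.unfilled]
  | succ n ih => rw [Params.unfilled, idla_univ, ih]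

lemma unfilled_nonneg (n : ℕ) (A : Finset V) : 0 ≤ a.unfilled n A := by
  induction n generalizing A with
  | zero => rw [Params.unfilled]; split_ifs <;> norm_num
  | succ n ih => exact Finset.sum_nonneg fun z _ => mul_nonneg (settle_nonneg a A z) (ih _)

lemma unfilled_le_one (n : ℕ) (A : Finset V) : a.unfilled n A ≤ 1 := by
  induction n generalizing A with
  | zero => rw [Params.unfilled]; split_ifs <;> norm_num
  | succ n ih => exact (idla_mono a A fun z => ih _).trans (idla_const a A 1).le

lemma unfilled_antitone (A : Finset V) : Antitone fun n => a.unfilled n A := by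
  refine antitone_nat_of_succ_le fun n => ?_
  induction n generalizing A with
  | zero =>
    by_cases hA : A = Finset.univ
    · rw [hA, unfilled_univ, unfilled_univ]
    · refine (unfilled_le_one a _ A).trans ?_
      simp [Params.unfilled, hA]
  | succ n ih => exact idla_mono a A fun z => ih _

/-- Chebyshev's inequality, upper tail of the filling time. -/
lemma unfilled_mul_sq_le (n : ℕ) (c : ℝ) (hc : 0 ≤ n + c) (A : Finset V) :
    a.unfilled n A * (n + c) ^ 2 ≤ a.quad c A := by
  induction n generalizing A c with
  | zero =>
    by_cases hA : A = Finset.univ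
    · rw [hA, unfilled_univ, zero_mul]
      exact quad_nonneg a c _
    · simp only [Nat.cast_zero, zero_add] at hc
      have h0 := fillTime_nonneg a A
      have h1 : 0 ≤ a.fillTime A / a.gap := div_nonneg h0 (gap_pos a).le
      simp only [Params.unfilled, hA, if_false, Params.quad]
      push_cast
      nlinarith
  | succ n ih =>
    by_cases hA : A = Finset.univ
    · rw [hA, unfilled_univ, zero_mul]
      exact quad_nonneg a c _
    · refine le_trans ?_ (idla_quad_le a hA c)
      rw [Params.unfilled, Params.idla, Params.idla, Finset.sum_mul]
      refine Finset.sum_le_sum fun z _ => ?_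
      rw [mul_assoc]
      refine mul_le_mul_of_nonneg_left ?_ (settle_nonneg a A z)
      have e : ((n + 1 : ℕ) : ℝ) + c = n + (c + 1) := by push_cast; ring
      rw [e] at hc ⊢
      exact ih (c + 1) hc (insert z A)

/-- Chebyshev's inequality, lower tail of the filling time. -/
lemma one_sub_unfilled_mul_sq_le (n : ℕ) (c : ℝ) (hc : n + c ≤ 0) (A : Finset V) :
    (1 - a.unfilled n A) * (n + c) ^ 2 ≤ a.quad c A := by
  have huniv : ∀ (n : ℕ) (c : ℝ), n + c ≤ 0 →
      (1 - a.unfilled n Finset.univ) * (n + c) ^ 2 ≤ a.quad c Finset.univ := fun n c hc => by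
    rw [unfilled_univ, Params.quad, fillTime_univ]
    have : (0 : ℝ) ≤ n := Nat.cast_nonneg n
    simp only [sub_zero, one_mul, zero_add, zero_div, add_zero]
    nlinarith
  induction n generalizing A c with
  | zero =>
    by_cases hA : A = Finset.univ
    · exact hA ▸ huniv 0 c hc
    · simp only [Params.unfilled, hA, if_false, sub_self, zero_mul]
      exact quad_nonneg a c A
  | succ n ih =>
    by_cases hA : A = Finset.univ
    · exact hA ▸ huniv (n + 1) c hc
    · refine le_trans ?_ (idla_quad_le a hA c)
      have h1 : 1 - a.unfilled (n + 1) A =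
          ∑ z, a.settle A z * (1 - a.unfilled n (insert z A)) := by
        simp only [mul_sub, mul_one, Finset.sum_sub_distrib, sum_settle]
        rfl
      rw [h1, Params.idla, Finset.sum_mul]
      refine Finset.sum_le_sum fun z _ => ?_
      rw [mul_assoc]
      refine mul_le_mul_of_nonneg_left ?_ (settle_nonneg a A z)
      have e : ((n + 1 : ℕ) : ℝ) + c = n + (c + 1) := by push_cast; ring
      rw [e] at hc ⊢
      exact ih (c + 1) hc (insert z A)

/-- At least one walk per empty site is needed. -/
lemma unfilled_eq_one {n : ℕ} {A : Finset V} (h : n < Aᶜ.card) : a.unfilled n A = 1 := by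
  induction n generalizing A with
  | zero =>
    have : A ≠ Finset.univ := by rintro rfl; simp at h
    simp [Params.unfilled, this]
  | succ n ih =>
    have : ∀ z, a.unfilled n (insert z A) = 1 := fun z => by
      refine ih ?_
      have h1 := Finset.card_insert_le z A
      have h2 := Finset.card_add_card_compl A
      have h3 := Finset.card_add_card_compl (insert z A)
      omega
    simp [Params.unfilled, Params.idla, this, sum_settle]

/-- With one walk per empty site, the filling fails only if some walk dies inside the aggregate. -/
lemma unfilled_card_le (A : Finset V) : a.unfilled Aᶜ.card A ≤ Aᶜ.card * (1 - a.gap) := by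
  induction hn : Aᶜ.card generalizing A with
  | zero =>
    have : A = Finset.univ := by simpa using hn
    rw [this, unfilled_univ]
    simp
  | succ n ih =>
    have hA : A ≠ Finset.univ := by rintro rfl; simp at hn
    have hg := gap_le a hA
    have hg1 := gap_le_one a
    have h1 : ∑ z ∈ Aᶜ, a.settle A z * a.unfilled n (insert z A) ≤ n * (1 - a.gap) := by
      have h2 : ∀ z ∈ Aᶜ, a.settle A z * a.unfilled n (insert z A) ≤
          a.settle A z * (n * (1 - a.gap)) := fun z hz => by
        refine mul_le_mul_of_nonneg_left (ih _ ?_) (settle_nonneg a A z)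
        have h1 := Finset.card_insert_of_notMem (Finset.mem_compl.1 hz)
        have h2 := Finset.card_add_card_compl A
        have h3 := Finset.card_add_card_compl (insert z A)
        omega
      refine (Finset.sum_le_sum h2).trans ?_
      rw [← Finset.sum_mul]
      exact mul_le_of_le_one_left (mul_nonneg (Nat.cast_nonneg n) (by linarith))
        (exitProb_le_one a A)
    rw [Params.unfilled, idla_eq]
    have h3 := unfilled_le_one a n A
    have h4 := unfilled_nonneg a n A
    push_cast
    nlinarith [exitProb_le_one a A]

/-! ### The Abelian property -/

/-- An active particle tries to fall asleep: this fails in the presence of other particles. -/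
def SiteState.doze : SiteState → SiteState
  | .active 1 => .asleep
  | s => s

/-- Apply `g` to the state of the site `x`. -/
def modifySite (x : V) (g : SiteState → SiteState) (η : V → SiteState) : V → SiteState :=
  Function.update η x (g (η x))

/-- Execution of one instruction by an active particle at `x`: `none` is an attempt to sleep,
`some none` is the death of the particle, and `some (some y)` is a jump to `y`. -/
def topple (x : V) : Option (Option V) → (V → SiteState) → (V → SiteState)
  | none, η => modifySite x SiteState.doze η
  | some none, η => removeParticle η x
  | some (some y), η => addParticle (removeParticle η x) y

/-- The probability of each instruction at `x`. -/
def Params.instr (a : Params V) (x : V) : Option (Option V) → ℝ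
  | none => a.lam / (1 + a.lam)
  | some none => (1 - ∑ y, a.K x y) / (1 + a.lam)
  | some (some y) => a.K x y / (1 + a.lam)

/-- The site `x` holds at least one active particle. -/
def IsActive (η : V → SiteState) (x : V) : Prop := 0 < (η x).activeCount

/-- Every particle is asleep. -/
def IsStable (η : V → SiteState) : Prop := ∀ x, ¬ IsActive η x

/-- The mean of `f` after toppling `x` once. -/
def Params.toppleMean (a : Params V) (f : (V → SiteState) → ℝ) (x : V) (η : V → SiteState) : ℝ :=
  ∑ i, a.instr x i * f (topple x i η)

/-- The functions which are invariant under all legal topplings. -/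
def Params.IsHarmonic (a : Params V) (f : (V → SiteState) → ℝ) : Prop :=
  ∀ η x, IsActive η x → a.toppleMean f x η = f η

lemma instr_nonneg (x : V) (i : Option (Option V)) : 0 ≤ a.instr x i := by
  have := a.lam_pos
  rcases i with _ | _ | y
  · exact div_nonneg a.lam_pos.le (by linarith)
  · exact div_nonneg (by linarith [a.K_row_le x]) (by linarith)
  · exact div_nonneg (a.K_nonneg x y) (by linarith)

lemma toppleMean_eq (f : (V → SiteState) → ℝ) (x : V) (η : V → SiteState) :
    a.toppleMean f x η = (a.lam * f (modifySite x SiteState.doze η) +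
      (1 - ∑ y, a.K x y) * f (removeParticle η x) +
      ∑ y, a.K x y * f (addParticle (removeParticle η x) y)) / (1 + a.lam) := by
  simp only [Params.toppleMean, Fintype.sum_option, Params.instr, topple, add_div, Finset.sum_div]
  simp only [div_mul_eq_mul_div, ← add_assoc]

lemma sum_instr (x : V) : ∑ i, a.instr x i = 1 := by
  have h := toppleMean_eq a (fun _ => 1) x (fun _ => SiteState.asleep)
  have := a.lam_pos
  simp only [Params.toppleMean, mul_one] at h
  rw [h, div_eq_one_iff_eq (by linarith)]
  ring

lemma toppleMean_mono {f g : (V → SiteState) → ℝ} {x : V} {η : V → SiteState}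
    (h : ∀ i, f (topple x i η) ≤ g (topple x i η)) : a.toppleMean f x η ≤ a.toppleMean g x η :=
  Finset.sum_le_sum fun i _ => mul_le_mul_of_nonneg_left (h i) (instr_nonneg a x i)

lemma toppleMean_const (c : ℝ) (x : V) (η : V → SiteState) :
    a.toppleMean (fun _ => c) x η = c := by
  rw [Params.toppleMean, ← Finset.sum_mul, sum_instr, one_mul]

lemma modifySite_comm {x y : V} (hxy : x ≠ y) (g g' : SiteState → SiteState) (η : V → SiteState) :
    modifySite x g (modifySite y g' η) = modifySite y g' (modifySite x g η) := by
  unfold modifySite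
  rw [Function.update_of_ne hxy, Function.update_of_ne hxy.symm, Function.update_comm hxy]

lemma addParticle_comm (η : V → SiteState) (x y : V) :
    addParticle (addParticle η x) y = addParticle (addParticle η y) x := by
  by_cases hxy : x = y
  · rw [hxy]
  · exact modifySite_comm (Ne.symm hxy) SiteState.arrive SiteState.arrive η

lemma arrive_leave {s : SiteState} (hs : 0 < s.activeCount) : s.arrive.leave = s.leave.arrive := by
  rcases s with (_ | k) | _
  · exact absurd hs (lt_irrefl 0)
  · rfl
  · exact absurd hs (lt_irrefl 0)

lemma arrive_doze {s : SiteState} (hs : 0 < s.activeCount) : s.arrive.doze = s.doze.arrive := by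
  rcases s with (_ | _ | k) | _
  · exact absurd hs (lt_irrefl 0)
  all_goals rfl

lemma modifySite_addParticle {x : V} {η : V → SiteState} {g : SiteState → SiteState}
    (hg : (η x).arrive.doze = (η x).doze.arrive → (g (η x).arrive) = (g (η x)).arrive)
    (hx : IsActive η x) (y : V) :
    modifySite x g (addParticle η y) = addParticle (modifySite x g η) y := by
  by_cases hxy : x = y
  · subst hxy
    simp [modifySite, addParticle, hg (arrive_doze hx)]
  · exact modifySite_comm hxy g SiteState.arrive η

lemma removeParticle_addParticle {x : V} {η : V → SiteState} (hx : IsActive η x) (y : V) :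
    removeParticle (addParticle η y) x = addParticle (removeParticle η x) y :=
  modifySite_addParticle (g := SiteState.leave) (fun _ => arrive_leave hx) hx y

/-- Topplings commute with the insertion of a particle. -/
lemma topple_addParticle {x : V} {η : V → SiteState} (hx : IsActive η x) (i : Option (Option V))
    (y : V) : topple x i (addParticle η y) = addParticle (topple x i η) y := by
  rcases i with _ | _ | z
  · exact modifySite_addParticle (g := SiteState.doze) id hx y
  · exact removeParticle_addParticle hx y
  · simp only [topple]
    rw [removeParticle_addParticle hx, addParticle_comm]

lemma IsActive.modifySite {x y : V} {η : V → SiteState} (hy : IsActive η y) (hxy : x ≠ y)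
    (g : SiteState → SiteState) : IsActive (modifySite x g η) y := by
  unfold IsActive ARW.modifySite
  rwa [Function.update_of_ne hxy.symm]

lemma isActive_addParticle_self (η : V → SiteState) (x : V) : IsActive (addParticle η x) x := by
  unfold IsActive addParticle
  rw [Function.update_self]
  cases η x <;> simp [SiteState.arrive, SiteState.activeCount]

lemma IsActive.addParticle {y : V} {η : V → SiteState} (hy : IsActive η y) (x : V) :
    IsActive (addParticle η x) y := by
  by_cases hxy : x = y
  · exact hxy ▸ isActive_addParticle_self η x
  · exact hy.modifySite hxy _

/-- Toppling a site does not deactivate the other sites. -/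
lemma IsActive.topple {x y : V} {η : V → SiteState} (hy : IsActive η y) (hxy : x ≠ y)
    (i : Option (Option V)) : IsActive (topple x i η) y := by
  rcases i with _ | _ | z
  · exact hy.modifySite hxy _
  · exact hy.modifySite hxy _
  · exact IsActive.addParticle (hy.modifySite hxy _) z

/-- Topplings at different active sites commute. -/
lemma topple_comm {x y : V} {η : V → SiteState} (hx : IsActive η x) (hy : IsActive η y)
    (hxy : x ≠ y) (i j : Option (Option V)) :
    topple y j (topple x i η) = topple x i (topple y j η) := by
  have key : ∀ g, topple y j (modifySite x g η) = modifySite x g (topple y j η) →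
    ∀ z, topple y j (addParticle (modifySite x g η) z) =
      addParticle (modifySite x g (topple y j η)) z := fun g h z => by
    rw [topple_addParticle (hy.modifySite hxy g), h]
  have base : ∀ g : SiteState → SiteState,
      (∀ z, modifySite x g (addParticle (removeParticle η y) z) =
        addParticle (modifySite x g (removeParticle η y)) z) →
      topple y j (modifySite x g η) = modifySite x g (topple y j η) := fun g h => by
    rcases j with _ | _ | z
    · exact modifySite_comm hxy.symm _ _ _
    · exact modifySite_comm hxy.symm _ _ _
    · simp only [topple]
      rw [h]
      congr 1
      exact modifySite_comm hxy.symm _ _ _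
  have hx' : IsActive (removeParticle η y) x := hx.modifySite hxy.symm _
  have hleave := base SiteState.leave (removeParticle_addParticle hx')
  rcases i with _ | _ | z
  · exact base SiteState.doze (modifySite_addParticle id hx')
  · exact hleave
  · exact key _ hleave z

lemma toppleMean_comm {x y : V} {η : V → SiteState} (hx : IsActive η x) (hy : IsActive η y)
    (hxy : x ≠ y) (f : (V → SiteState) → ℝ) :
    a.toppleMean (a.toppleMean f y) x η = a.toppleMean (a.toppleMean f x) y η := by
  simp only [Params.toppleMean, Finset.mul_sum]
  rw [Finset.sum_comm]
  refine Finset.sum_congr rfl fun j _ => Finset.sum_congr rfl fun i _ => ?_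
  rw [topple_comm hx hy hxy]
  ring

open Classical in
/-- The probability that `η` is stabilized into `ξ` by at most `n` topplings, performed at sites
chosen by an arbitrary rule. -/
def Params.stabWithin (a : Params V) (ξ : V → SiteState) : ℕ → (V → SiteState) → ℝ
  | 0, η => if η = ξ then 1 else 0
  | n + 1, η => if h : ∃ x, IsActive η x then a.toppleMean (a.stabWithin ξ n) h.choose η
      else if η = ξ then 1 else 0

lemma stabWithin_of_isStable (ξ : V → SiteState) (n : ℕ) {η : V → SiteState} (hη : IsStable η) :
    a.stabWithin ξ n η = if η = ξ then 1 else 0 := by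
  have h : ¬ ∃ x, IsActive η x := fun ⟨x, hx⟩ => hη x hx
  cases n with
  | zero => rfl
  | succ n => rw [Params.stabWithin, dif_neg h]

lemma stabWithin_zero_of_isActive {ξ η : V → SiteState} (hξ : IsStable ξ) {x : V}
    (hx : IsActive η x) : a.stabWithin ξ 0 η = 0 := by
  rw [Params.stabWithin, if_neg]
  rintro rfl
  exact hξ x hx

/-- Abelian property: the choice of the site to be toppled is irrelevant. -/
lemma stabWithin_succ {ξ : V → SiteState} (hξ : IsStable ξ) (n : ℕ) {η : V → SiteState} {x : V}
    (hx : IsActive η x) : a.stabWithin ξ (n + 1) η = a.toppleMean (a.stabWithin ξ n) x η := by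
  induction n generalizing η x with
  | zero =>
    have h : ∃ x, IsActive η x := ⟨x, hx⟩
    rw [Params.stabWithin, dif_pos h]
    by_cases hxy : h.choose = x
    · rw [hxy]
    · have h1 : ∀ i, a.stabWithin ξ 0 (topple h.choose i η) = 0 := fun i =>
        stabWithin_zero_of_isActive a hξ (hx.topple hxy i)
      have h2 : ∀ i, a.stabWithin ξ 0 (topple x i η) = 0 := fun i =>
        stabWithin_zero_of_isActive a hξ (h.choose_spec.topple (Ne.symm hxy) i)
      simp [Params.toppleMean, h1, h2]
  | succ n ih =>
    have h : ∃ x, IsActive η x := ⟨x, hx⟩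
    rw [Params.stabWithin, dif_pos h]
    by_cases hxy : h.choose = x
    · rw [hxy]
    · have h1 : a.toppleMean (a.stabWithin ξ (n + 1)) h.choose η =
          a.toppleMean (a.toppleMean (a.stabWithin ξ n) x) h.choose η :=
        Finset.sum_congr rfl fun i _ => by rw [ih (hx.topple hxy i)]
      have h2 : a.toppleMean (a.stabWithin ξ (n + 1)) x η =
          a.toppleMean (a.toppleMean (a.stabWithin ξ n) h.choose) x η :=
        Finset.sum_congr rfl fun i _ => by rw [ih (h.choose_spec.topple (Ne.symm hxy) i)]
      rw [h1, h2, toppleMean_comm a h.choose_spec hx hxy]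

lemma stabWithin_nonneg {ξ : V → SiteState} (hξ : IsStable ξ) (n : ℕ) (η : V → SiteState) :
    0 ≤ a.stabWithin ξ n η := by
  induction n generalizing η with
  | zero => rw [Params.stabWithin]; split_ifs <;> norm_num
  | succ n ih =>
    by_cases h : ∃ x, IsActive η x
    · obtain ⟨x, hx⟩ := h
      rw [stabWithin_succ a hξ n hx, ← toppleMean_const a 0 x η]
      exact toppleMean_mono a fun i => ih _
    · rw [stabWithin_of_isStable a ξ _ fun x hx => h ⟨x, hx⟩]
      split_ifs <;> norm_num

lemma stabWithin_le_one {ξ : V → SiteState} (hξ : IsStable ξ) (n : ℕ) (η : V → SiteState) :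
    a.stabWithin ξ n η ≤ 1 := by
  induction n generalizing η with
  | zero => rw [Params.stabWithin]; split_ifs <;> norm_num
  | succ n ih =>
    by_cases h : ∃ x, IsActive η x
    · obtain ⟨x, hx⟩ := h
      rw [stabWithin_succ a hξ n hx]
      exact (toppleMean_mono a fun i => ih _).trans (toppleMean_const a 1 x η).le
    · rw [stabWithin_of_isStable a ξ _ fun x hx => h ⟨x, hx⟩]
      split_ifs <;> norm_num

lemma stabWithin_mono {ξ : V → SiteState} (hξ : IsStable ξ) (η : V → SiteState) :
    Monotone fun n => a.stabWithin ξ n η := by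
  refine monotone_nat_of_le_succ fun n => ?_
  induction n generalizing η with
  | zero =>
    by_cases h : ∃ x, IsActive η x
    · obtain ⟨x, hx⟩ := h
      rw [stabWithin_zero_of_isActive a hξ hx]
      exact stabWithin_nonneg a hξ _ _
    · have h : IsStable η := fun x hx => h ⟨x, hx⟩
      rw [stabWithin_of_isStable a ξ _ h, stabWithin_of_isStable a ξ _ h]
  | succ n ih =>
    by_cases h : ∃ x, IsActive η x
    · obtain ⟨x, hx⟩ := h
      rw [stabWithin_succ a hξ n hx, stabWithin_succ a hξ (n + 1) hx]
      exact toppleMean_mono a fun i => ih _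
    · have h : IsStable η := fun x hx => h ⟨x, hx⟩
      rw [stabWithin_of_isStable a ξ _ h, stabWithin_of_isStable a ξ _ h]

/-- The probability that legal topplings eventually transform `η` into the stable
configuration `ξ`. -/
def Params.stab (a : Params V) (η : V → SiteState) (ξ : V → Bool) : ℝ :=
  ⨆ n, a.stabWithin (ofStable ξ) n η

lemma isStable_ofStable (ξ : V → Bool) : IsStable (ofStable ξ) := fun x => by
  unfold IsActive ofStable
  split_ifs <;> simp [SiteState.activeCount]

lemma IsStable.exists_eq {η : V → SiteState} (hη : IsStable η) : ∃ ξ, η = ofStable ξ := by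
  refine ⟨fun x => decide (η x = SiteState.asleep), funext fun x => ?_⟩
  have hx := hη x
  unfold IsActive at hx
  unfold ofStable
  cases h : η x with
  | active k =>
    rw [h, SiteState.activeCount] at hx
    simp [h, Nat.eq_zero_of_not_pos hx]
  | asleep => simp [h]

lemma ofStable_injective : Function.Injective (ofStable : (V → Bool) → V → SiteState) := by
  intro ξ ξ' h
  funext x
  have := congrFun h x
  unfold ofStable at this
  revert this
  cases ξ x <;> cases ξ' x <;> simp

lemma tendsto_stabWithin (η : V → SiteState) (ξ : V → Bool) :
    Tendsto (fun n => a.stabWithin (ofStable ξ) n η) atTop (𝓝 (a.stab η ξ)) :=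
  tendsto_atTop_ciSup (stabWithin_mono a (isStable_ofStable ξ) η)
    ⟨1, Set.forall_mem_range.2 fun n => stabWithin_le_one a (isStable_ofStable ξ) n η⟩

lemma stab_nonneg (η : V → SiteState) (ξ : V → Bool) : 0 ≤ a.stab η ξ :=
  ge_of_tendsto' (tendsto_stabWithin a η ξ) fun n => stabWithin_nonneg a (isStable_ofStable ξ) n η

lemma stab_ofStable (η ξ : V → Bool) : a.stab (ofStable η) ξ = if η = ξ then 1 else 0 := by
  simp only [Params.stab, stabWithin_of_isStable a (ofStable ξ) _ (isStable_ofStable η),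
    ofStable_injective.eq_iff, ciSup_const]

lemma isHarmonic_stab (ξ : V → Bool) : a.IsHarmonic fun η => a.stab η ξ := by
  intro η x hx
  refine tendsto_nhds_unique ?_ ((tendsto_stabWithin a η ξ).comp (tendsto_add_atTop_nat 1))
  have : ∀ n, ((fun n => a.stabWithin (ofStable ξ) n η) ∘ fun n => n + 1) n =
      a.toppleMean (a.stabWithin (ofStable ξ) n) x η := fun n =>
    stabWithin_succ a (isStable_ofStable ξ) n hx
  refine Tendsto.congr (fun n => (this n).symm) ?_
  exact tendsto_finsetSum _ fun i _ => (tendsto_stabWithin a _ ξ).const_mul _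

lemma count_doze (s : SiteState) : s.doze.count = s.count := by
  rcases s with (_ | _ | k) | _ <;> rfl

lemma count_leave_lt {s : SiteState} (hs : 0 < s.activeCount) : s.leave.count + 1 = s.count := by
  rcases s with k | _
  · exact Nat.sub_add_cancel hs
  · exact absurd hs (lt_irrefl 0)

lemma numParticles_modifySite (x : V) (g : SiteState → SiteState) (η : V → SiteState) :
    numParticles (modifySite x g η) + (η x).count = numParticles η + (g (η x)).count := by
  unfold numParticles modifySite
  rw [← Finset.add_sum_erase _ _ (Finset.mem_univ x),
    ← Finset.add_sum_erase _ (fun y => (η y).count) (Finset.mem_univ x)]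
  have h : ∑ y ∈ Finset.univ.erase x, (Function.update η x (g (η x)) y).count =
      ∑ y ∈ Finset.univ.erase x, (η y).count :=
    Finset.sum_congr rfl fun y hy => by rw [Function.update_of_ne (Finset.ne_of_mem_erase hy)]
  rw [h, Function.update_self]
  omega

lemma numParticles_removeParticle {x : V} {η : V → SiteState} (hx : IsActive η x) :
    numParticles (removeParticle η x) + 1 = numParticles η := by
  have h1 := numParticles_modifySite x SiteState.leave η
  have h2 := count_leave_lt hx
  change numParticles (removeParticle η x) + _ = _ at h1
  omega

lemma numParticles_topple_le {x : V} {η : V → SiteState} (hx : IsActive η x)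
    (i : Option (Option V)) : numParticles (topple x i η) ≤ numParticles η := by
  have h := numParticles_removeParticle hx
  rcases i with _ | _ | y
  · have := numParticles_modifySite x SiteState.doze η
    rw [count_doze] at this
    simp only [topple]
    omega
  · simp only [topple]
    omega
  · simp only [topple]
    rw [numParticles_addParticle]
    omega

lemma stab_eq_zero_of_numParticles_lt {η : V → SiteState} {ξ : V → Bool}
    (h : numParticles η < numParticles (ofStable ξ)) : a.stab η ξ = 0 := by
  have key : ∀ n η, numParticles η < numParticles (ofStable ξ) →
      a.stabWithin (ofStable ξ) n η = 0 := fun n => by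
    induction n with
    | zero =>
      intro η h
      rw [Params.stabWithin, if_neg]
      rintro rfl
      exact lt_irrefl _ h
    | succ n ih =>
      intro η h
      by_cases hη : ∃ x, IsActive η x
      · obtain ⟨x, hx⟩ := hη
        rw [stabWithin_succ a (isStable_ofStable ξ) n hx]
        exact Finset.sum_eq_zero fun i _ => by
          rw [ih _ ((numParticles_topple_le hx i).trans_lt h), mul_zero]
      · rw [stabWithin_of_isStable a _ _ fun x hx => hη ⟨x, hx⟩, if_neg]
        rintro rfl
        exact lt_irrefl _ h
  simp [Params.stab, key _ η h]

/-! ### The continuous-time dynamics -/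

section Exponential

variable {S : Type*} [Fintype S] [DecidableEq S]

open Matrix in
lemma hasDerivAt_exp_smul_mulVec (Q : Matrix S S ℝ) (v : S → ℝ) (t : ℝ) (i : S) :
    HasDerivAt (fun t : ℝ => (NormedSpace.exp (t • Q) *ᵥ v) i)
      ((NormedSpace.exp (t • Q) *ᵥ (Q *ᵥ v)) i) t := by
  let _ : NormedRing (Matrix S S ℝ) := Matrix.linftyOpNormedRing
  let _ : NormedAlgebra ℝ (Matrix S S ℝ) := Matrix.linftyOpNormedAlgebra
  have h := hasDerivAt_exp_smul_const (𝕂 := ℝ) Q t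
  let l : Matrix S S ℝ →ₗ[ℝ] ℝ :=
    { toFun := fun M => (M *ᵥ v) i
      map_add' := fun M N => by rw [Matrix.add_mulVec, Pi.add_apply]
      map_smul' := fun c M => by rw [Matrix.smul_mulVec, Pi.smul_apply, RingHom.id_apply] }
  have h2 := (LinearMap.toContinuousLinearMap l).hasFDerivAt.comp_hasDerivAt t h
  rw [Matrix.mulVec_mulVec]
  exact h2

lemma exp_apply_nonneg_of_nonneg {M : Matrix S S ℝ} (hM : ∀ i j, 0 ≤ M i j) (i j : S) :
    0 ≤ NormedSpace.exp M i j := by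
  let _ : NormedRing (Matrix S S ℝ) := Matrix.linftyOpNormedRing
  let _ : NormedAlgebra ℝ (Matrix S S ℝ) := Matrix.linftyOpNormedAlgebra
  have hpow : ∀ (n : ℕ) i j, 0 ≤ (M ^ n) i j := fun n => by
    induction n with
    | zero => intro i j; rw [pow_zero, Matrix.one_apply]; split_ifs <;> norm_num
    | succ n ih =>
      intro i j
      rw [pow_succ, Matrix.mul_apply]
      exact Finset.sum_nonneg fun k _ => mul_nonneg (ih i k) (hM k j)
  have h := NormedSpace.exp_series_hasSum_exp' (𝕂 := ℝ) M
  have h2 : HasSum (fun n : ℕ => ((n.factorial : ℝ)⁻¹ • M ^ n) i j) (NormedSpace.exp M i j) := by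
    have h3 := Pi.hasSum.1 h i
    exact Pi.hasSum.1 h3 j
  refine h2.nonneg fun n => ?_
  rw [Matrix.smul_apply, smul_eq_mul]
  exact mul_nonneg (by positivity) (hpow n i j)

/-- Adding a multiple of the identity makes a generator entrywise nonnegative. -/
lemma exp_smul_apply_nonneg {Q : Matrix S S ℝ} (hQ : ∀ i j, i ≠ j → 0 ≤ Q i j) {t : ℝ}
    (ht : 0 ≤ t) (i j : S) : 0 ≤ NormedSpace.exp (t • Q) i j := by
  set c : ℝ := ∑ k, |Q k k| with hc
  have hck : ∀ k, 0 ≤ Q k k + c := fun k => by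
    have h1 : |Q k k| ≤ c := Finset.single_le_sum (f := fun k => |Q k k|)
      (fun _ _ => abs_nonneg _) (Finset.mem_univ k)
    have h2 := neg_abs_le (Q k k)
    linarith
  have hsplit : t • Q = t • (Q + c • (1 : Matrix S S ℝ)) + (-(t * c)) • (1 : Matrix S S ℝ) := by
    rw [smul_add, smul_smul, add_assoc, ← add_smul]
    simp
  have hdiag : NormedSpace.exp ((-(t * c)) • (1 : Matrix S S ℝ)) =
      Real.exp (-(t * c)) • (1 : Matrix S S ℝ) := by
    rw [← Matrix.diagonal_one, ← Matrix.diagonal_smul, Matrix.exp_diagonal,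
      ← Matrix.diagonal_smul]
    congr 1
    funext k
    rw [Pi.coe_exp]
    simp [Real.exp_eq_exp_ℝ]
  rw [hsplit, Matrix.exp_add_of_commute _ _ (Commute.smul_right (Commute.one_right _) _), hdiag,
    Matrix.mul_smul, mul_one, Matrix.smul_apply, smul_eq_mul]
  refine mul_nonneg (Real.exp_pos _).le (exp_apply_nonneg_of_nonneg (fun k l => ?_) i j)
  simp only [Matrix.smul_apply, Matrix.add_apply, smul_eq_mul, Matrix.one_apply]
  refine mul_nonneg ht ?_
  by_cases hkl : k = l
  · subst hkl
    simpa using hck k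
  · simpa [hkl] using hQ k l hkl

end Exponential

/-- The generator of the dynamics, acting on functions on all configurations. -/
def Params.genFun (a : Params V) (f : (V → SiteState) → ℝ) (η : V → SiteState) : ℝ :=
  ∑ x, (((η x).activeCount : ℝ) *
      (∑ y, a.K x y * (f (addParticle (removeParticle η x) y) - f η) +
        (1 - ∑ y, a.K x y) * (f (removeParticle η x) - f η)) +
    if η x = SiteState.active 1 then
      a.lam * (f (Function.update η x SiteState.asleep) - f η) else 0)

lemma rate_nonneg (η ξ : V → SiteState) : 0 ≤ rate a η ξ := by
  refine Finset.sum_nonneg fun x _ => add_nonneg (mul_nonneg (Nat.cast_nonneg _)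
    (add_nonneg (Finset.sum_nonneg fun y _ => ?_) ?_)) ?_
  · split_ifs
    exacts [a.K_nonneg x y, le_rfl]
  · split_ifs
    exacts [sub_nonneg.2 (a.K_row_le x), le_rfl]
  · split_ifs
    exacts [a.lam_pos.le, le_rfl]

lemma sum_config_ite {N : ℕ} {ζ : V → SiteState} (hζ : numParticles ζ ≤ N) (c : ℝ)
    (g : (V → SiteState) → ℝ) :
    ∑ ξ : Config V N, (if ξ.1 = ζ then c else 0) * g ξ.1 = c * g ζ := by
  let ζ' : Config V N := ⟨ζ, hζ⟩
  refine (Finset.sum_eq_single (M := ℝ) ζ' (fun ξ _ hξ => ?_)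
    fun h => absurd (Finset.mem_univ _) h).trans ?_
  · rw [if_neg, zero_mul]
    exact fun h => hξ (Subtype.ext h)
  · rw [if_pos rfl]

lemma sum_rate_mul {N : ℕ} (η : Config V N) (g : (V → SiteState) → ℝ) :
    ∑ ξ : Config V N, rate a η.1 ξ.1 * g ξ.1 =
      ∑ x, (((η.1 x).activeCount : ℝ) *
        (∑ y, a.K x y * g (addParticle (removeParticle η.1 x) y) +
          (1 - ∑ y, a.K x y) * g (removeParticle η.1 x)) +
      if η.1 x = SiteState.active 1 then
        a.lam * g (Function.update η.1 x SiteState.asleep) else 0) := by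
  simp only [rate, Finset.sum_mul]
  rw [Finset.sum_comm]
  refine Finset.sum_congr rfl fun x _ => ?_
  simp only [add_mul, Finset.sum_add_distrib, mul_assoc, Finset.sum_mul, ← Finset.mul_sum]
  have hη := η.2
  congr 1
  · by_cases hx : IsActive η.1 x
    · have h := numParticles_removeParticle hx
      congr 2
      · rw [Finset.sum_comm]
        refine Finset.sum_congr rfl fun y _ => sum_config_ite ?_ _ g
        rw [numParticles_addParticle]
        omega
      · exact sum_config_ite (by omega) _ g
    · have : (η.1 x).activeCount = 0 := Nat.eq_zero_of_not_pos hx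
      simp [this]
  · by_cases hx : η.1 x = SiteState.active 1
    · simp only [hx, true_and, if_true]
      refine sum_config_ite ?_ _ g
      have := numParticles_modifySite x (fun _ => SiteState.asleep) η.1
      rw [hx] at this
      have h2 : numParticles (Function.update η.1 x SiteState.asleep) + 1 = numParticles η.1 + 1 :=
        this
      omega
    · simp [hx]

open Matrix in
lemma generator_mulVec {N : ℕ} (f : (V → SiteState) → ℝ) (η : Config V N) :
    (generator a N *ᵥ fun ξ => f ξ.1) η = a.genFun f η.1 := by
  have h0 : (generator a N *ᵥ fun ξ => f ξ.1) η =
      ∑ ξ : Config V N, rate a η.1 ξ.1 * f ξ.1 - (∑ ξ : Config V N, rate a η.1 ξ.1) * f η.1 := by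
    rw [generator, Matrix.sub_mulVec, Pi.sub_apply, Matrix.mulVec_diagonal]
    rfl
  have h1 : ∑ ξ : Config V N, rate a η.1 ξ.1 * f ξ.1 - (∑ ξ : Config V N, rate a η.1 ξ.1) * f η.1 =
      ∑ ξ : Config V N, rate a η.1 ξ.1 * (f ξ.1 - f η.1) := by
    simp only [mul_sub, Finset.sum_sub_distrib, Finset.sum_mul]
  rw [h0, h1, sum_rate_mul a η fun ζ => f ζ - f η.1]
  rfl

lemma generator_offDiag_nonneg {N : ℕ} (η ξ : Config V N) (h : η ≠ ξ) : 0 ≤ generator a N η ξ := by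
  simp only [generator, Matrix.sub_apply, Matrix.of_apply, Matrix.diagonal_apply_ne _ h, sub_zero]
  exact rate_nonneg a _ _

lemma doze_of_ne {s : SiteState} (h : s ≠ SiteState.active 1) : s.doze = s := by
  rcases s with (_ | _ | k) | _
  · rfl
  · exact absurd rfl h
  · rfl
  · rfl

lemma modifySite_doze_of_ne {η : V → SiteState} {x : V} (h : η x ≠ SiteState.active 1) :
    modifySite x SiteState.doze η = η := by
  rw [modifySite, doze_of_ne h, Function.update_eq_self]

lemma modifySite_doze {η : V → SiteState} {x : V} (h : η x = SiteState.active 1) :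
    modifySite x SiteState.doze η = Function.update η x SiteState.asleep := by
  rw [modifySite, h]
  rfl

/-- A function is invariant under all legal topplings only if it is harmonic for the continuous-time
dynamics. -/
lemma genFun_eq_zero {f : (V → SiteState) → ℝ} (hf : a.IsHarmonic f) (η : V → SiteState) :
    a.genFun f η = 0 := by
  refine Finset.sum_eq_zero fun x _ => ?_
  have hl := a.lam_pos
  by_cases hx : IsActive η x
  · have h := hf η x hx
    rw [toppleMean_eq, div_eq_iff (by linarith)] at h
    have h2 : ∑ y, a.K x y * (f (addParticle (removeParticle η x) y) - f η) +
        (1 - ∑ y, a.K x y) * (f (removeParticle η x) - f η) =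
        a.lam * (f η - f (modifySite x SiteState.doze η)) := by
      simp only [mul_sub, Finset.sum_sub_distrib, ← Finset.sum_mul]
      linarith
    rw [h2]
    split_ifs with h1
    · rw [modifySite_doze h1, h1]
      simp only [SiteState.activeCount]
      push_cast
      ring
    · rw [modifySite_doze_of_ne h1]
      simp
  · have h0 : (η x).activeCount = 0 := Nat.eq_zero_of_not_pos hx
    have h1 : η x ≠ SiteState.active 1 := fun h => by rw [h] at h0; cases h0
    simp [h0, h1]

lemma genFun_of_isStable (f : (V → SiteState) → ℝ) {η : V → SiteState} (hη : IsStable η) :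
    a.genFun f η = 0 := by
  refine Finset.sum_eq_zero fun x _ => ?_
  have h0 : (η x).activeCount = 0 := Nat.eq_zero_of_not_pos (hη x)
  have h1 : η x ≠ SiteState.active 1 := fun h => by rw [h] at h0; cases h0
  simp [h0, h1]

/-- The expected lifetime of the killed walk. -/
def Params.lifetime (a : Params V) (x : V) : ℝ := ∑ z, a.green Finset.univ x z

lemma lifetime_eq (x : V) : a.lifetime x = ∑ y, a.K x y * a.lifetime y + 1 := by
  have := sum_green_eq a Finset.univ (fun _ => 1) x
  simpa [restrict_of_mem, Params.lifetime] using this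

lemma one_le_lifetime (x : V) : 1 ≤ a.lifetime x := by
  rw [lifetime_eq]
  have : 0 ≤ ∑ y, a.K x y * a.lifetime y := Finset.sum_nonneg fun y _ =>
    mul_nonneg (a.K_nonneg x y) (Finset.sum_nonneg fun z _ => green_nonneg a _ _ _)
  linarith

/-- The contribution of one site to the Lyapunov function: `g` per particle, with a discount `1/2`
for a sleeping particle. -/
def SiteState.energy (g : ℝ) : SiteState → ℝ
  | .active k => k * g
  | .asleep => g - 1 / 2

/-- A Lyapunov function of the dynamics: the total expected lifetime of all particles, with a
discount for the sleeping ones. -/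
def Params.energy (a : Params V) (η : V → SiteState) : ℝ := ∑ x, (η x).energy (a.lifetime x)

lemma energy_nonneg (η : V → SiteState) : 0 ≤ a.energy η := by
  refine Finset.sum_nonneg fun x _ => ?_
  have := one_le_lifetime a x
  cases η x with
  | active k => exact mul_nonneg (Nat.cast_nonneg k) (by linarith)
  | asleep => simp only [SiteState.energy]; linarith

lemma energy_modifySite (x : V) (g : SiteState → SiteState) (η : V → SiteState) :
    a.energy (modifySite x g η) =
      a.energy η + ((g (η x)).energy (a.lifetime x) - (η x).energy (a.lifetime x)) := by
  unfold Params.energy modifySite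
  rw [← Finset.add_sum_erase _ _ (Finset.mem_univ x),
    ← Finset.add_sum_erase _ (fun y => (η y).energy (a.lifetime y)) (Finset.mem_univ x)]
  have h : ∑ y ∈ Finset.univ.erase x, (Function.update η x (g (η x)) y).energy (a.lifetime y) =
      ∑ y ∈ Finset.univ.erase x, (η y).energy (a.lifetime y) :=
    Finset.sum_congr rfl fun y hy => by rw [Function.update_of_ne (Finset.ne_of_mem_erase hy)]
  rw [h, Function.update_self]
  ring

lemma energy_addParticle_le (η : V → SiteState) (x : V) :
    a.energy (addParticle η x) ≤ a.energy η + a.lifetime x + 1 / 2 := by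
  have h := energy_modifySite a x SiteState.arrive η
  change a.energy (addParticle η x) = _ at h
  rw [h]
  cases η x with
  | active k => simp only [SiteState.arrive, SiteState.energy]; push_cast; linarith
  | asleep => simp only [SiteState.arrive, SiteState.energy]; push_cast; linarith

lemma energy_removeParticle {η : V → SiteState} {x : V} (hx : IsActive η x) :
    a.energy (removeParticle η x) = a.energy η - a.lifetime x := by
  have h := energy_modifySite a x SiteState.leave η
  change a.energy (removeParticle η x) = _ at h
  rw [h]
  unfold IsActive at hx
  cases hs : η x with
  | active k =>
    rw [hs] at hx
    have hx : 1 ≤ k := hx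
    simp only [SiteState.leave, SiteState.energy]
    push_cast [Nat.cast_sub hx]
    ring
  | asleep => rw [hs] at hx; exact absurd hx (lt_irrefl 0)

/-- A jump or a death decreases the energy by at least `1 / 2` on average, even though a sleeping
particle may be woken up. -/
lemma energy_jump_le {η : V → SiteState} {x : V} (hx : IsActive η x) :
    ∑ y, a.K x y * (a.energy (addParticle (removeParticle η x) y) - a.energy η) +
      (1 - ∑ y, a.K x y) * (a.energy (removeParticle η x) - a.energy η) ≤ -(1 / 2) := by
  have h1 : ∑ y, a.K x y * (a.energy (addParticle (removeParticle η x) y) - a.energy η) ≤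
      ∑ y, a.K x y * (a.lifetime y + (1 / 2 - a.lifetime x)) := by
    refine Finset.sum_le_sum fun y _ => mul_le_mul_of_nonneg_left ?_ (a.K_nonneg x y)
    have := energy_addParticle_le a (removeParticle η x) y
    rw [energy_removeParticle a hx] at this
    linarith
  rw [energy_removeParticle a hx]
  simp only [mul_add, Finset.sum_add_distrib, ← Finset.sum_mul] at h1
  have h2 := lifetime_eq a x
  have h3 := a.K_row_le x
  linarith

lemma genFun_energy_le {η : V → SiteState} (hη : ¬ IsStable η) :
    a.genFun a.energy η ≤ -(1 / 2) := by
  have hterm : ∀ x, (((η x).activeCount : ℝ) *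
      (∑ y, a.K x y * (a.energy (addParticle (removeParticle η x) y) - a.energy η) +
        (1 - ∑ y, a.K x y) * (a.energy (removeParticle η x) - a.energy η)) +
      if η x = SiteState.active 1 then
        a.lam * (a.energy (Function.update η x SiteState.asleep) - a.energy η) else 0) ≤
      -(1 / 2) * (η x).activeCount := fun x => by
    have hsleep : (if η x = SiteState.active 1 then
        a.lam * (a.energy (Function.update η x SiteState.asleep) - a.energy η) else 0) ≤ 0 := by
      split_ifs with h
      · rw [← modifySite_doze h, energy_modifySite, h]
        refine mul_nonpos_of_nonneg_of_nonpos a.lam_pos.le ?_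
        simp only [SiteState.doze, SiteState.energy]
        push_cast
        linarith
      · exact le_rfl
    by_cases hx : IsActive η x
    · have := mul_le_mul_of_nonneg_left (energy_jump_le a hx)
        (Nat.cast_nonneg (α := ℝ) (η x).activeCount)
      linarith
    · have h0 : (η x).activeCount = 0 := Nat.eq_zero_of_not_pos hx
      rw [h0]
      simpa using hsleep
  refine (Finset.sum_le_sum fun x _ => hterm x).trans ?_
  rw [← Finset.mul_sum]
  obtain ⟨x, hx⟩ : ∃ x, IsActive η x := by
    by_contra! h
    exact hη h
  have h1 : (1 : ℝ) ≤ ∑ x, ((η x).activeCount : ℝ) := by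
    have h2 : (1 : ℝ) ≤ (η x).activeCount := by exact_mod_cast hx
    exact h2.trans (Finset.single_le_sum (f := fun x => ((η x).activeCount : ℝ))
      (fun _ _ => Nat.cast_nonneg _) (Finset.mem_univ x))
  linarith

open Classical in
/-- The indicator of the unstable configurations. -/
def unstableInd (η : V → SiteState) : ℝ := if IsStable η then 0 else 1

lemma genFun_unstableInd_nonpos (η : V → SiteState) : a.genFun unstableInd η ≤ 0 := by
  by_cases hη : IsStable η
  · exact (genFun_of_isStable a _ hη).le
  have h : ∀ ζ : V → SiteState, unstableInd ζ - unstableInd η ≤ 0 := fun ζ => by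
    unfold unstableInd
    rw [if_neg hη]
    split_ifs <;> norm_num
  refine Finset.sum_nonpos fun x _ => add_nonpos
    (mul_nonpos_of_nonneg_of_nonpos (Nat.cast_nonneg _) (add_nonpos
      (Finset.sum_nonpos fun y _ => mul_nonpos_of_nonneg_of_nonpos (a.K_nonneg x y) (h _))
      (mul_nonpos_of_nonneg_of_nonpos (sub_nonneg.2 (a.K_row_le x)) (h _)))) ?_
  split_ifs
  · exact mul_nonpos_of_nonneg_of_nonpos a.lam_pos.le (h _)
  · exact le_rfl

lemma transitionProb_nonneg {N : ℕ} {t : ℝ} (ht : 0 ≤ t) (η ξ : Config V N) :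
    0 ≤ transitionProb a N t η ξ :=
  exp_smul_apply_nonneg (generator_offDiag_nonneg a) ht η ξ

lemma hasDerivAt_sum_transitionProb {N : ℕ} (η : Config V N) (f : (V → SiteState) → ℝ) (t : ℝ) :
    HasDerivAt (fun t => ∑ ξ, transitionProb a N t η ξ * f ξ.1)
      (∑ ξ, transitionProb a N t η ξ * a.genFun f ξ.1) t := by
  have h := hasDerivAt_exp_smul_mulVec (generator a N) (fun ξ => f ξ.1) t η
  have h2 : Matrix.mulVec (generator a N) (fun ξ => f ξ.1) = fun ξ => a.genFun f ξ.1 :=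
    funext fun ξ => generator_mulVec a f ξ
  rw [h2] at h
  exact h

lemma sum_transitionProb_zero {N : ℕ} (η : Config V N) (f : (V → SiteState) → ℝ) :
    ∑ ξ, transitionProb a N 0 η ξ * f ξ.1 = f η.1 := by
  simp [transitionProb, Matrix.one_apply]

lemma sum_transitionProb_of_isHarmonic {N : ℕ} (η : Config V N) {f : (V → SiteState) → ℝ}
    (hf : a.IsHarmonic f) (t : ℝ) : ∑ ξ, transitionProb a N t η ξ * f ξ.1 = f η.1 := by
  have h : ∀ t, HasDerivAt (fun t => ∑ ξ, transitionProb a N t η ξ * f ξ.1) 0 t := fun t => by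
    have := hasDerivAt_sum_transitionProb a η f t
    simpa [genFun_eq_zero a hf] using this
  rw [← sum_transitionProb_zero a η f]
  exact is_const_of_deriv_eq_zero (fun t => (h t).differentiableAt) (fun t => (h t).deriv) t 0

/-- Mean energy plus `t / 2` times the unstable mass is nonincreasing in time. -/
lemma unstable_mass_le {N : ℕ} (η : Config V N) {t : ℝ} (ht : 0 ≤ t) :
    t / 2 * ∑ ξ, transitionProb a N t η ξ * unstableInd ξ.1 ≤ a.energy η.1 := by
  set F : ℝ → ℝ := fun t => ∑ ξ, transitionProb a N t η ξ * a.energy ξ.1 +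
    t / 2 * ∑ ξ, transitionProb a N t η ξ * unstableInd ξ.1 with hF
  have hd : ∀ t, HasDerivAt F (∑ ξ, transitionProb a N t η ξ * a.genFun a.energy ξ.1 +
      (1 / 2 * ∑ ξ, transitionProb a N t η ξ * unstableInd ξ.1 +
        t / 2 * ∑ ξ, transitionProb a N t η ξ * a.genFun unstableInd ξ.1)) t := fun t =>
    (hasDerivAt_sum_transitionProb a η _ t).add
      (((hasDerivAt_id t).div_const 2).mul (hasDerivAt_sum_transitionProb a η _ t))
  have hanti : AntitoneOn F (Set.Ici 0) := by
    refine antitoneOn_of_deriv_nonpos (convex_Ici 0)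
      (fun t _ => (hd t).continuousAt.continuousWithinAt)
      (fun t _ => (hd t).differentiableAt.differentiableWithinAt) fun t ht => ?_
    rw [interior_Ici, Set.mem_Ioi] at ht
    rw [(hd t).deriv, ← add_assoc, Finset.mul_sum, ← Finset.sum_add_distrib]
    refine add_nonpos (Finset.sum_nonpos fun ξ _ => ?_) (mul_nonpos_of_nonneg_of_nonpos
      (by linarith) (Finset.sum_nonpos fun ξ _ => mul_nonpos_of_nonneg_of_nonpos
        (transitionProb_nonneg a ht.le η ξ) (genFun_unstableInd_nonpos a ξ.1)))
    have h1 : a.genFun a.energy ξ.1 + 1 / 2 * unstableInd ξ.1 ≤ 0 := by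
      unfold unstableInd
      split_ifs with h
      · rw [genFun_of_isStable a _ h]
        norm_num
      · linarith [genFun_energy_le a h]
    have h2 := mul_nonpos_of_nonneg_of_nonpos (transitionProb_nonneg a ht.le η ξ) h1
    linarith
  have h := hanti (Set.mem_Ici.2 le_rfl) (Set.mem_Ici.2 ht) ht
  simp only [hF, zero_div, zero_mul, add_zero] at h
  rw [sum_transitionProb_zero] at h
  have h2 : 0 ≤ ∑ ξ, transitionProb a N t η ξ * a.energy ξ.1 := Finset.sum_nonneg fun ξ _ =>
    mul_nonneg (transitionProb_nonneg a ht η ξ) (energy_nonneg a ξ.1)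
  linarith

/-- The dynamics is absorbed in the stable configurations: a function which vanishes on them has
vanishing mean at large times. -/
lemma tendsto_sum_transitionProb_of_stable {N : ℕ} (η : Config V N) {f : (V → SiteState) → ℝ}
    (hf : ∀ ξ : Config V N, IsStable ξ.1 → f ξ.1 = 0) :
    Tendsto (fun t => ∑ ξ, transitionProb a N t η ξ * f ξ.1) atTop (𝓝 0) := by
  set C : ℝ := ∑ ξ : Config V N, |f ξ.1| with hC
  have hC0 : 0 ≤ C := Finset.sum_nonneg fun _ _ => abs_nonneg _
  have hb : ∀ ξ : Config V N, |f ξ.1| ≤ C * unstableInd ξ.1 := fun ξ => by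
    unfold unstableInd
    split_ifs with h
    · simp [hf ξ h]
    · rw [mul_one]
      exact Finset.single_le_sum (f := fun ξ : Config V N => |f ξ.1|)
        (fun _ _ => abs_nonneg _) (Finset.mem_univ ξ)
  have hlim : Tendsto (fun t : ℝ => C * (2 * a.energy η.1) * t⁻¹) atTop (𝓝 0) := by
    simpa using (tendsto_inv_atTop_zero (𝕜 := ℝ)).const_mul (C * (2 * a.energy η.1))
  refine squeeze_zero_norm' ?_ hlim
  filter_upwards [eventually_gt_atTop (0 : ℝ)] with t ht
  rw [Real.norm_eq_abs]
  have h1 := unstable_mass_le a η ht.le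
  have h2 : ∑ ξ, transitionProb a N t η ξ * unstableInd ξ.1 ≤ 2 * a.energy η.1 * t⁻¹ := by
    rw [← div_eq_mul_inv, le_div_iff₀ ht]
    linarith
  calc |∑ ξ, transitionProb a N t η ξ * f ξ.1|
      ≤ ∑ ξ, |transitionProb a N t η ξ * f ξ.1| := Finset.abs_sum_le_sum_abs _ _
    _ ≤ ∑ ξ, C * (transitionProb a N t η ξ * unstableInd ξ.1) := by
        refine Finset.sum_le_sum fun ξ _ => ?_
        rw [abs_mul, abs_of_nonneg (transitionProb_nonneg a ht.le η ξ)]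
        have := mul_le_mul_of_nonneg_left (hb ξ) (transitionProb_nonneg a ht.le η ξ)
        linarith
    _ = C * ∑ ξ, transitionProb a N t η ξ * unstableInd ξ.1 := by rw [Finset.mul_sum]
    _ ≤ C * (2 * a.energy η.1 * t⁻¹) := mul_le_mul_of_nonneg_left h2 hC0
    _ = C * (2 * a.energy η.1) * t⁻¹ := by ring

/-- Uniqueness in the Dirichlet problem with boundary values on the stable configurations. -/
lemma eq_zero_of_isHarmonic {f : (V → SiteState) → ℝ} (hf : a.IsHarmonic f)
    (h0 : ∀ ξ : V → Bool, f (ofStable ξ) = 0) (η : V → SiteState) : f η = 0 := by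
  have h := tendsto_sum_transitionProb_of_stable a (N := numParticles η) ⟨η, le_rfl⟩ (f := f)
    fun ξ hξ => by
      obtain ⟨ζ, hζ⟩ := hξ.exists_eq
      rw [hζ, h0]
  refine tendsto_nhds_unique tendsto_const_nhds (h.congr fun t => ?_)
  exact sum_transitionProb_of_isHarmonic a _ hf t

lemma isHarmonic_sub_sum {ι : Type*} [Fintype ι] {f : (V → SiteState) → ℝ} (hf : a.IsHarmonic f)
    {g : ι → (V → SiteState) → ℝ} (hg : ∀ i, a.IsHarmonic (g i)) (c : ι → ℝ) :
    a.IsHarmonic fun η => f η - ∑ i, g i η * c i := by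
  intro η x hx
  have h1 := hf η x hx
  have h2 := fun i => hg i η x hx
  simp only [Params.toppleMean] at h1 h2 ⊢
  rw [← h1]
  simp only [← h2, mul_sub, Finset.sum_sub_distrib, Finset.mul_sum, Finset.sum_mul]
  congr 1
  rw [Finset.sum_comm]
  simp only [mul_assoc]

/-- A harmonic function is determined by its values on the stable configurations. -/
lemma sum_stab_mul {f : (V → SiteState) → ℝ} (hf : a.IsHarmonic f) (η : V → SiteState) :
    ∑ ξ, a.stab η ξ * f (ofStable ξ) = f η := by
  have h := eq_zero_of_isHarmonic a
    (isHarmonic_sub_sum a hf (g := fun ξ η => a.stab η ξ) (isHarmonic_stab a)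
      fun ξ => f (ofStable ξ)) (fun ζ => by simp [stab_ofStable]) η
  linarith

/-- The continuous-time dynamics and the toppling procedure stabilize a configuration to the same
random stable configuration. -/
lemma stabilizationProb_eq {N : ℕ} (η ζ : Config V N) {ξ : V → Bool} (hζ : ζ.1 = ofStable ξ) :
    stabilizationProb a N η ζ = a.stab η.1 ξ := by
  refine Tendsto.limUnder_eq ?_
  have h := tendsto_sum_transitionProb_of_stable a η
    (f := fun ω => a.stab ω ξ - if ω = ofStable ξ then 1 else 0) fun ω hω => by
      obtain ⟨θ, hθ⟩ := hω.exists_eq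
      rw [hθ, stab_ofStable]
      simp [ofStable_injective.eq_iff]
  have h2 : ∀ t, ∑ ω : Config V N, transitionProb a N t η ω *
      (a.stab ω.1 ξ - if ω.1 = ofStable ξ then 1 else 0) =
      a.stab η.1 ξ - transitionProb a N t η ζ := fun t => by
    simp only [mul_sub, Finset.sum_sub_distrib]
    rw [sum_transitionProb_of_isHarmonic a η (isHarmonic_stab a ξ)]
    congr 1
    rw [Finset.sum_eq_single ζ]
    · simp [hζ]
    · intro ω _ hω
      rw [if_neg, mul_zero]
      exact fun h => hω (Subtype.ext (h.trans hζ.symm))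
    · exact fun h => absurd (Finset.mem_univ _) h
  simp only [h2] at h
  have h3 := h.const_sub (a.stab η.1 ξ)
  simpa using h3

/-! ### From activated random walks to internal DLA -/

lemma isHarmonic_const (c : ℝ) : a.IsHarmonic fun _ => c := fun η x _ => toppleMean_const a c x η

lemma isHarmonic_sum {ι : Type*} [Fintype ι] {g : ι → (V → SiteState) → ℝ}
    (hg : ∀ i, a.IsHarmonic (g i)) (c : ι → ℝ) : a.IsHarmonic fun η => ∑ i, g i η * c i := by
  simpa using isHarmonic_sub_sum a (isHarmonic_const a 0) hg fun i => -c i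

lemma isHarmonic_addParticle {f : (V → SiteState) → ℝ} (hf : a.IsHarmonic f) (y : V) :
    a.IsHarmonic fun η => f (addParticle η y) := by
  intro η x hx
  refine Eq.trans ?_ (hf (addParticle η y) x (hx.addParticle y))
  exact Finset.sum_congr rfl fun i _ => by rw [topple_addParticle hx]

lemma sum_stab (η : V → SiteState) : ∑ ξ, a.stab η ξ = 1 := by
  simpa using sum_stab_mul a (isHarmonic_const a 1) η

lemma chain_apply (η ξ : V → Bool) :
    chain a η ξ = ∑ x, a.ν x * a.stab (addParticle (ofStable η) x) ξ :=
  Finset.sum_congr rfl fun x _ => by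
    rw [stabilizationProb_eq a (insertedConfig η x) (stableConfig ξ) (ξ := ξ) rfl]
    rfl

/-- Stabilizing before the insertion of a particle does not change the final outcome. -/
lemma sum_stab_mul_chain (η : V → SiteState) (ξ : V → Bool) :
    ∑ ζ, a.stab η ζ * chain a ζ ξ = ∑ x, a.ν x * a.stab (addParticle η x) ξ := by
  simp only [chain_apply, Finset.mul_sum]
  rw [Finset.sum_comm]
  refine Finset.sum_congr rfl fun x _ => ?_
  rw [← sum_stab_mul a (isHarmonic_addParticle a (isHarmonic_stab a ξ) x) η, Finset.mul_sum]
  exact Finset.sum_congr rfl fun ζ _ => by ring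

/-- A particle added to an active site can be carried one step further without touching the
other particles. -/
lemma carry_particle {f : (V → SiteState) → ℝ} (hf : a.IsHarmonic f) {η : V → SiteState} {x : V}
    (hx : IsActive η x) :
    f (addParticle η x) = ∑ y, a.K x y * f (addParticle η y) + (1 - ∑ y, a.K x y) * f η := by
  have hrem : removeParticle (addParticle η x) x = η := by
    unfold removeParticle addParticle
    rw [Function.update_self, Function.update_idem]
    unfold IsActive at hx
    cases hs : η x with
    | active k =>
      simp only [SiteState.arrive, SiteState.leave, Nat.add_sub_cancel]
      rw [← hs, Function.update_eq_self]
    | asleep => rw [hs] at hx; exact absurd hx (lt_irrefl 0)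
  have hdoze : modifySite x SiteState.doze (addParticle η x) = addParticle η x := by
    refine modifySite_doze_of_ne fun h => ?_
    unfold addParticle at h
    rw [Function.update_self] at h
    unfold IsActive at hx
    cases hs : η x with
    | active k =>
      rw [hs, SiteState.arrive, SiteState.active.injEq] at h
      rw [hs, SiteState.activeCount] at hx
      omega
    | asleep => rw [hs] at hx; exact absurd hx (lt_irrefl 0)
  have h := hf _ x (isActive_addParticle_self η x)
  have hl := a.lam_pos
  rw [toppleMean_eq, hrem, hdoze, div_eq_iff (by linarith)] at h
  linarith

/-- One active particle is added to `ζ` at each site of `A`. -/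
def pile (A : Finset V) (ζ : V → SiteState) : V → SiteState :=
  fun x => if x ∈ A then (ζ x).arrive else ζ x

/-- All sites hold exactly one active particle. -/
def ones : V → SiteState := fun _ => SiteState.active 1

/-- The configuration without particles. -/
def emptyConfig : V → Bool := fun _ => false

/-- The configuration with a sleeping particle at each site. -/
def fullConfig : V → Bool := fun _ => true

lemma pile_empty (ζ : V → SiteState) : pile ∅ ζ = ζ := by
  funext x
  simp [pile]

lemma isActive_pile {A : Finset V} {x : V} (hx : x ∈ A) (ζ : V → SiteState) :
    IsActive (pile A ζ) x := by
  unfold IsActive pile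
  rw [if_pos hx]
  cases ζ x <;> simp [SiteState.arrive, SiteState.activeCount]

lemma addParticle_pile {A : Finset V} {x : V} (hx : x ∉ A) (ζ : V → SiteState) :
    addParticle (pile A ζ) x = pile (insert x A) ζ := by
  funext y
  by_cases hy : y = x
  · subst hy
    simp [addParticle, pile, hx]
  · simp [addParticle, pile, hy]

/-- A particle inserted according to `ν` is carried until it is killed or finds a site outside `A`:
the added particles perform internal DLA, ignoring the particles of `ζ`. -/
lemma sum_addParticle_pile {f : (V → SiteState) → ℝ} (hf : a.IsHarmonic f) (A : Finset V)
    (ζ : V → SiteState) :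
    ∑ x, a.ν x * f (addParticle (pile A ζ) x) = a.idla (fun B => f (pile B ζ)) A := by
  rw [Params.idla, sum_settle_mul]
  refine Finset.sum_congr rfl fun x _ => ?_
  congr 1
  refine eq_sum_lastSite a (w := fun x => f (addParticle (pile A ζ) x)) (fun x => ?_) x
  by_cases hx : x ∈ A
  · simp only [restrict_of_mem a hx, stopProb_of_mem a hx, Finset.insert_eq_of_mem hx]
    exact carry_particle a hf (isActive_pile hx ζ)
  · simp [restrict_of_notMem a hx, stopProb_of_notMem a hx, addParticle_pile hx]

/-- When all sites are active, an additional particle may be carried until it is killed. -/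
lemma eq_of_forall_isActive {f : (V → SiteState) → ℝ} (hf : a.IsHarmonic f) {η : V → SiteState}
    (hη : ∀ x, IsActive η x) (x : V) : f (addParticle η x) = f η := by
  have := eq_sum_lastSite a (A := Finset.univ) (w := fun x => f (addParticle η x))
    (b := fun _ => f η) (fun x => by
      simp only [restrict_of_mem a (Finset.mem_univ x), stopProb_of_mem a (Finset.mem_univ x)]
      exact carry_particle a hf (hη x)) x
  rw [this, ← Finset.sum_mul, sum_lastSite, one_mul]

lemma eq_ones_of_pile_univ {f : (V → SiteState) → ℝ} (hf : a.IsHarmonic f) (η : V → Bool) :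
    f (pile Finset.univ (ofStable η)) = f ones := by
  have h : ∀ B, f (pile B ones) = f ones := fun B => by
    induction B using Finset.induction_on with
    | empty => rw [pile_empty]
    | insert x B hx ih =>
      rw [← addParticle_pile hx, eq_of_forall_isActive a hf (fun y => ?_), ih]
      by_cases hy : y ∈ B
      · exact isActive_pile hy _
      · unfold IsActive pile
        rw [if_neg hy]
        exact Nat.one_pos
  rw [← h (Finset.univ.filter fun x => η x = true)]
  congr 1
  funext x
  cases hx : η x <;> simp [pile, ofStable, ones, hx, SiteState.arrive]

/-- The law of the stabilization of the configuration with one active particle per site. -/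
def Params.stationary (a : Params V) (ξ : V → Bool) : ℝ := a.stab ones ξ

lemma stationary_nonneg (ξ : V → Bool) : 0 ≤ a.stationary ξ := stab_nonneg a _ _

lemma sum_stationary : ∑ ξ, a.stationary ξ = 1 := sum_stab a _

lemma sum_stationary_mul_chain (ξ : V → Bool) :
    ∑ η, a.stationary η * chain a η ξ = a.stationary ξ := by
  unfold Params.stationary
  rw [sum_stab_mul_chain]
  have : ∀ x, a.stab (addParticle ones x) ξ = a.stab ones ξ := fun x =>
    eq_of_forall_isActive a (isHarmonic_stab a ξ) (η := ones) (fun _ => Nat.one_pos) x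
  simp only [this, ← Finset.sum_mul, a.ν_sum, one_mul]

lemma lam_div_mul_le {f : (V → SiteState) → ℝ} (hf : a.IsHarmonic f) (h0 : ∀ η, 0 ≤ f η)
    {η : V → SiteState} {x : V} (hx : IsActive η x) :
    a.lam / (1 + a.lam) * f (modifySite x SiteState.doze η) ≤ f η := by
  rw [← hf η x hx]
  exact Finset.single_le_sum (f := fun i => a.instr x i * f (topple x i η))
    (fun i _ => mul_nonneg (instr_nonneg a x i) (h0 _)) (Finset.mem_univ none)

/-- If all the particles of the configuration `ξ` are active, they may all fall asleep in place. -/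
lemma stab_pile_pos (ξ : V → Bool) :
    0 < a.stab (pile (Finset.univ.filter fun x => ξ x = true) (ofStable emptyConfig)) ξ := by
  have hl : 0 < a.lam / (1 + a.lam) := div_pos a.lam_pos (by linarith [a.lam_pos])
  have key : ∀ B : Finset V, B ⊆ Finset.univ.filter (fun x => ξ x = true) →
      0 < a.stab (fun x => if x ∈ B then SiteState.active 1 else ofStable ξ x) ξ := fun B => by
    induction B using Finset.induction_on with
    | empty =>
      intro _
      have h : (fun x => if x ∈ (∅ : Finset V) then SiteState.active 1 else ofStable ξ x) =
          ofStable ξ := funext fun x => by simp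
      rw [h, stab_ofStable, if_pos rfl]
      exact one_pos
    | insert x B hx ih =>
      intro hB
      have h1 := ih ((Finset.subset_insert x B).trans hB)
      have hξ : ξ x = true := (Finset.mem_filter.1 (hB (Finset.mem_insert_self x B))).2
      have hact : (fun y => if y ∈ insert x B then SiteState.active 1 else ofStable ξ y) x =
          SiteState.active 1 := by simp
      have h2 := lam_div_mul_le a (isHarmonic_stab a ξ) (fun η => stab_nonneg a η ξ)
        (η := fun y => if y ∈ insert x B then SiteState.active 1 else ofStable ξ y) (x := x)
        (by unfold IsActive; rw [hact]; exact Nat.one_pos)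
      have h3 : modifySite x SiteState.doze
          (fun y => if y ∈ insert x B then SiteState.active 1 else ofStable ξ y) =
          fun y => if y ∈ B then SiteState.active 1 else ofStable ξ y := by
        rw [modifySite_doze (x := x) (η := fun y =>
          if y ∈ insert x B then SiteState.active 1 else ofStable ξ y) hact]
        funext y
        by_cases hy : y = x
        · subst hy
          simp [hx, ofStable, hξ]
        · simp [hy]
      rw [h3] at h2
      exact (mul_pos hl h1).trans_le h2
  have h : pile (Finset.univ.filter fun x => ξ x = true) (ofStable emptyConfig) =
      fun x => if x ∈ Finset.univ.filter (fun x => ξ x = true) then SiteState.active 1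
        else ofStable ξ x := by
    funext x
    cases hx : ξ x <;> simp [pile, ofStable, emptyConfig, hx, SiteState.arrive]
  rw [h]
  exact key _ subset_rfl

/-- One particle can be removed: walking it to its death has positive probability, since otherwise
the sites from which this is impossible would carry a stochastic principal sub-matrix. -/
lemma stab_addParticle_pos {η : V → SiteState} {ξ : V → Bool} (h : 0 < a.stab η ξ)
    (hη : ∀ x, IsActive η x ∨ η x = SiteState.active 0) (x : V) :
    0 < a.stab (addParticle η x) ξ := by
  have hl := a.lam_pos
  set w : V → ℝ := fun x => a.stab (addParticle η x) ξ with hw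
  have hw0 : ∀ x, 0 ≤ w x := fun x => stab_nonneg a _ _
  -- at an empty site the walk may be stopped by sleep, but moves on with positive probability
  have hle : ∀ x, ∑ y, a.K x y * w y + (1 - ∑ y, a.K x y) * a.stab η ξ ≤
      (1 + a.lam) * w x := fun x => by
    rcases hη x with hx | hx
    · rw [hw, ← carry_particle a (isHarmonic_stab a ξ) hx]
      have := hw0 x
      simp only [hw] at this
      nlinarith
    · have hrem : removeParticle (addParticle η x) x = η := by
        unfold removeParticle addParticle
        rw [Function.update_self, Function.update_idem, hx]
        simp only [SiteState.arrive, SiteState.leave, Nat.add_sub_cancel]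
        rw [← hx, Function.update_eq_self]
      have h1 := isHarmonic_stab a ξ _ x (isActive_addParticle_self η x)
      rw [toppleMean_eq, hrem, div_eq_iff (by linarith)] at h1
      have h2 := mul_nonneg hl.le
        (stab_nonneg a (modifySite x SiteState.doze (addParticle η x)) ξ)
      simp only [hw]
      linarith
  by_contra hx
  have hx0 : w x = 0 := le_antisymm (not_lt.1 hx) (hw0 x)
  refine a.K_nondegenerate (Finset.univ.filter fun z => w z = 0) ⟨x, by simp [hx0]⟩ fun z hz => ?_
  replace hz : w z = 0 := (Finset.mem_filter.1 hz).2
  have h1 := hle z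
  rw [hz, mul_zero] at h1
  have h2 : 0 ≤ ∑ y, a.K z y * w y :=
    Finset.sum_nonneg fun y _ => mul_nonneg (a.K_nonneg z y) (hw0 y)
  have h3 : 0 ≤ (1 - ∑ y, a.K z y) * a.stab η ξ :=
    mul_nonneg (sub_nonneg.2 (a.K_row_le z)) h.le
  have h4 : ∑ y, a.K z y * w y = 0 := by linarith
  have h5 : (1 - ∑ y, a.K z y) * a.stab η ξ = 0 := by linarith
  have h6 : ∑ y, a.K z y = 1 := by
    rcases mul_eq_zero.1 h5 with h | h'
    · linarith
    · exact absurd h' h.ne'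
  rw [← h6, Finset.sum_filter]
  refine Finset.sum_congr rfl fun y _ => ?_
  have h7 := (Finset.sum_eq_zero_iff_of_nonneg
    fun y _ => mul_nonneg (a.K_nonneg z y) (hw0 y)).1 h4 y (Finset.mem_univ y)
  split_ifs with hy
  · rfl
  · exact ((mul_eq_zero.1 h7).resolve_right hy).symm

lemma stationary_pos (ξ : V → Bool) : 0 < a.stationary ξ := by
  have key : ∀ B : Finset V, 0 < a.stab
      (pile (B ∪ Finset.univ.filter fun x => ξ x = true) (ofStable emptyConfig)) ξ := fun B => by
    induction B using Finset.induction_on with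
    | empty =>
      rw [Finset.empty_union]
      exact stab_pile_pos a ξ
    | insert x B _ ih =>
      rw [Finset.insert_union]
      by_cases hx : x ∈ B ∪ Finset.univ.filter fun x => ξ x = true
      · rwa [Finset.insert_eq_of_mem hx]
      · rw [← addParticle_pile hx]
        refine stab_addParticle_pos a ih (fun y => ?_) x
        by_cases hy : y ∈ B ∪ Finset.univ.filter fun x => ξ x = true
        · exact Or.inl (isActive_pile hy _)
        · refine Or.inr ?_
          simp only [pile, if_neg hy]
          rfl
  have h := key Finset.univ
  rwa [Finset.union_eq_left.2 (Finset.subset_univ _),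
    eq_ones_of_pile_univ a (isHarmonic_stab a ξ)] at h

lemma sum_stab_mul_pow_zero (η : V → SiteState) (ξ : V → Bool) :
    ∑ ζ, a.stab η ζ * (chain a ^ 0) ζ ξ = a.stab η ξ := by
  simp [Matrix.one_apply]

lemma sum_stab_pile_mul_pow_succ (n : ℕ) (A : Finset V) (ζ : V → SiteState) (ξ : V → Bool) :
    ∑ θ, a.stab (pile A ζ) θ * (chain a ^ (n + 1)) θ ξ =
      a.idla (fun B => ∑ θ, a.stab (pile B ζ) θ * (chain a ^ n) θ ξ) A := by
  rw [← sum_addParticle_pile a (f := fun η => ∑ θ, a.stab η θ * (chain a ^ n) θ ξ)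
    (isHarmonic_sum a (g := fun θ η => a.stab η θ) (isHarmonic_stab a) _)]
  have h : ∀ θ, ∑ x, a.ν x * a.stab (addParticle (pile A ζ) x) θ =
      ∑ θ', a.stab (pile A ζ) θ' * chain a θ' θ := fun θ => (sum_stab_mul_chain a _ θ).symm
  calc ∑ θ', a.stab (pile A ζ) θ' * (chain a ^ (n + 1)) θ' ξ
      = ∑ θ, (∑ θ', a.stab (pile A ζ) θ' * chain a θ' θ) * (chain a ^ n) θ ξ := by
        simp only [pow_succ', Matrix.mul_apply, Finset.mul_sum, Finset.sum_mul]
        rw [Finset.sum_comm]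
        simp only [mul_assoc]
    _ = _ := by
        simp only [← h, Finset.sum_mul, Finset.mul_sum]
        rw [Finset.sum_comm]
        simp only [mul_assoc]

/-- The filling time of internal DLA is a strong stationary time: once the added particles occupy
all sites, the remaining ones may be disregarded and the configuration is in equilibrium. -/
lemma le_sum_stab_pile_mul_pow (n : ℕ) (A : Finset V) (η ξ : V → Bool) :
    (1 - a.unfilled n A) * a.stationary ξ ≤
      ∑ θ, a.stab (pile A (ofStable η)) θ * (chain a ^ n) θ ξ := by
  induction n generalizing A with
  | zero =>
    rw [sum_stab_mul_pow_zero]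
    by_cases hA : A = Finset.univ
    · rw [hA, unfilled_univ, eq_ones_of_pile_univ a (isHarmonic_stab a ξ), sub_zero, one_mul]
      rfl
    · simp only [Params.unfilled, if_neg hA, sub_self, zero_mul]
      exact stab_nonneg a _ _
  | succ n ih =>
    rw [sum_stab_pile_mul_pow_succ]
    refine le_trans (le_of_eq ?_) (idla_mono a A
      (φ := fun B => (1 - a.unfilled n B) * a.stationary ξ) fun z => ih (insert z A))
    simp only [Params.idla, Params.unfilled, ← mul_assoc, ← Finset.sum_mul, mul_sub, mul_one,
      Finset.sum_sub_distrib, sum_settle]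

lemma numParticles_pile_empty (A : Finset V) :
    numParticles (pile A (ofStable emptyConfig)) = A.card := by
  have : ∀ x, (pile A (ofStable emptyConfig) x).count = if x ∈ A then 1 else 0 := fun x => by
    unfold pile ofStable emptyConfig
    split_ifs <;> simp_all [SiteState.arrive, SiteState.count]
  simp [numParticles, this]

/-- The chain started from the empty configuration cannot be full before internal DLA has filled
all sites. -/
lemma sum_stab_pile_mul_pow_full (n : ℕ) (A : Finset V) :
    ∑ θ, a.stab (pile A (ofStable emptyConfig)) θ * (chain a ^ n) θ fullConfig =
      (1 - a.unfilled n A) * a.stationary fullConfig := by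
  induction n generalizing A with
  | zero =>
    rw [sum_stab_mul_pow_zero]
    by_cases hA : A = Finset.univ
    · rw [hA, unfilled_univ, eq_ones_of_pile_univ a (isHarmonic_stab a fullConfig), sub_zero,
        one_mul]
      rfl
    · simp only [Params.unfilled, if_neg hA, sub_self, zero_mul]
      refine stab_eq_zero_of_numParticles_lt a ?_
      rw [numParticles_pile_empty]
      have : numParticles (ofStable (fullConfig : V → Bool)) = Fintype.card V := by
        simp [numParticles, ofStable, fullConfig, SiteState.count]
      rw [this]
      exact (Finset.card_lt_iff_ne_univ A).2 hA
  | succ n ih =>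
    rw [sum_stab_pile_mul_pow_succ]
    simp only [ih]
    simp only [Params.idla, Params.unfilled, ← mul_assoc, ← Finset.sum_mul, mul_sub, mul_one,
      Finset.sum_sub_distrib, sum_settle]

lemma sum_stab_pile_empty_mul (η ξ : V → Bool) (n : ℕ) :
    ∑ θ, a.stab (pile ∅ (ofStable η)) θ * (chain a ^ n) θ ξ = (chain a ^ n) η ξ := by
  simp [pile_empty, stab_ofStable]

lemma le_pow_chain (n : ℕ) (η ξ : V → Bool) :
    (1 - a.unfilled n ∅) * a.stationary ξ ≤ (chain a ^ n) η ξ := by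
  have := le_sum_stab_pile_mul_pow a n ∅ η ξ
  rwa [sum_stab_pile_empty_mul] at this

lemma pow_chain_full (n : ℕ) :
    (chain a ^ n) emptyConfig fullConfig = (1 - a.unfilled n ∅) * a.stationary fullConfig := by
  rw [← sum_stab_pile_mul_pow_full, sum_stab_pile_empty_mul]

lemma tendsto_unfilled (A : Finset V) : Tendsto (fun n => a.unfilled n A) atTop (𝓝 0) := by
  set h := a.fillTime A with hh
  have hlim : Tendsto (fun n : ℕ => a.quad (-h) A * ((n : ℝ) + -h)⁻¹) atTop (𝓝 0) := by
    have h1 : Tendsto (fun n : ℕ => (n : ℝ) + -h) atTop atTop :=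
      tendsto_atTop_add_const_right _ _ tendsto_natCast_atTop_atTop
    simpa using (tendsto_inv_atTop_zero.comp h1).const_mul (a.quad (-h) A)
  refine squeeze_zero' (Eventually.of_forall fun n => unfilled_nonneg a n A) ?_ hlim
  filter_upwards [(tendsto_natCast_atTop_atTop (R := ℝ)).eventually_ge_atTop (h + 1)] with n hn
  have hn1 : 1 ≤ (n : ℝ) + -h := by linarith
  have h2 := unfilled_mul_sq_le a n (-h) (by linarith) A
  rw [← div_eq_mul_inv, le_div_iff₀ (by linarith)]
  refine le_trans (mul_le_mul_of_nonneg_left ?_ (unfilled_nonneg a n A)) h2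
  nlinarith

/-! ### Distances to equilibrium -/

lemma invariantDistribution_chain : invariantDistribution (chain a) = a.stationary := by
  have hinv : IsInvariantDistribution (chain a) (invariantDistribution (chain a)) :=
    Classical.epsilon_spec (p := IsInvariantDistribution (chain a))
      ⟨a.stationary, stationary_nonneg a, sum_stationary a, sum_stationary_mul_chain a⟩
  obtain ⟨h0, h1, h2⟩ := hinv
  set π := invariantDistribution (chain a) with hπ
  have hpow : ∀ n ξ, ∑ η, π η * (chain a ^ n) η ξ = π ξ := fun n => by
    induction n with
    | zero => intro ξ; simp [Matrix.one_apply]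
    | succ n ih =>
      intro ξ
      simp only [pow_succ, Matrix.mul_apply, Finset.mul_sum, ← mul_assoc]
      rw [Finset.sum_comm]
      simp only [← Finset.sum_mul, ih, h2]
  have hle : ∀ ξ, a.stationary ξ ≤ π ξ := fun ξ => by
    have hlim : Tendsto (fun n => (1 - a.unfilled n ∅) * a.stationary ξ) atTop
        (𝓝 ((1 - 0) * a.stationary ξ)) := ((tendsto_unfilled a ∅).const_sub 1).mul_const _
    rw [sub_zero, one_mul] at hlim
    refine le_of_tendsto' hlim fun n => ?_
    rw [← hpow n ξ]
    calc (1 - a.unfilled n ∅) * a.stationary ξ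
        = ∑ η, π η * ((1 - a.unfilled n ∅) * a.stationary ξ) := by
          rw [← Finset.sum_mul, h1, one_mul]
      _ ≤ _ := Finset.sum_le_sum fun η _ =>
          mul_le_mul_of_nonneg_left (le_pow_chain a n η ξ) (h0 η)
  have heq : ∑ ξ, a.stationary ξ = ∑ ξ, π ξ := by rw [sum_stationary, h1]
  funext ξ
  exact ((Finset.sum_eq_sum_iff_of_le fun ξ _ => hle ξ).1 heq ξ (Finset.mem_univ ξ)).symm

/-- The separation distance is the probability that internal DLA is not over. -/
lemma sepDist_chain (n : ℕ) : sepDist (chain a) n = a.unfilled n ∅ := by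
  unfold sepDist
  rw [invariantDistribution_chain]
  refine le_antisymm (ciSup_le fun p => ?_) ?_
  · have h := le_pow_chain a n p.1 p.2
    rw [← le_div_iff₀ (stationary_pos a p.2)] at h
    linarith
  · refine le_trans (le_of_eq ?_) (le_ciSup (Set.finite_range _).bddAbove (emptyConfig, fullConfig))
    rw [pow_chain_full, mul_div_cancel_right₀ _ (stationary_pos a _).ne']
    ring

lemma sum_pow_chain (n : ℕ) (η : V → Bool) : ∑ ξ, (chain a ^ n) η ξ = 1 := by
  induction n with
  | zero => simp [Matrix.one_apply]
  | succ n ih =>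
    have h : ∀ η, ∑ ξ, chain a η ξ = 1 := fun η => by
      simp only [chain_apply]
      rw [Finset.sum_comm]
      simp only [← Finset.mul_sum, sum_stab, mul_one, a.ν_sum]
    simp only [pow_succ, Matrix.mul_apply]
    rw [Finset.sum_comm]
    simp only [← Finset.mul_sum, h, mul_one, ih]

lemma tvDist_chain_le (n : ℕ) : tvDist (chain a) n ≤ a.unfilled n ∅ := by
  unfold tvDist
  rw [invariantDistribution_chain]
  refine ciSup_le fun p => ?_
  have hlow : ∀ B : Finset (V → Bool), -a.unfilled n ∅ ≤
      ∑ y ∈ B, (chain a ^ n) p.1 y - ∑ y ∈ B, a.stationary y := fun B => by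
    have h1 : ∑ y ∈ B, (1 - a.unfilled n ∅) * a.stationary y ≤ ∑ y ∈ B, (chain a ^ n) p.1 y :=
      Finset.sum_le_sum fun y _ => le_pow_chain a n p.1 y
    have h2 : ∑ y ∈ B, a.stationary y ≤ 1 := by
      rw [← sum_stationary a]
      exact Finset.sum_le_sum_of_subset_of_nonneg (Finset.subset_univ B)
        fun y _ _ => stationary_nonneg a y
    rw [← Finset.mul_sum] at h1
    nlinarith [unfilled_nonneg a n ∅]
  have h1 := hlow p.2
  have h2 := hlow p.2ᶜ
  have h3 := Finset.sum_add_sum_compl p.2 fun y => (chain a ^ n) p.1 y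
  have h4 := Finset.sum_add_sum_compl p.2 fun y => a.stationary y
  rw [sum_pow_chain] at h3
  rw [sum_stationary] at h4
  exact abs_le.2 ⟨h1, by linarith⟩

open Matrix in
/-- `1 - gap` is an eigenvalue of the chain: if `y` is the site which is hardest to visit, then the
stabilization of one active particle at each site but `y` gives a left eigenvector after subtraction
of the stationary distribution. -/
lemma exists_eigenvector : ∃ f : (V → Bool) → ℝ, f ≠ 0 ∧
    ∀ η, ∑ ξ, chain a η ξ * f ξ = (1 - a.gap) * f η := by
  obtain ⟨y, hy⟩ := exists_gap_eq a
  set ρ : (V → Bool) → ℝ := fun ξ => a.stab (pile {y}ᶜ (ofStable emptyConfig)) ξ with hρ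
  have hρP : ∀ ξ, ∑ η, ρ η * chain a η ξ = (1 - a.gap) * ρ ξ + a.gap * a.stationary ξ := fun ξ => by
    rw [hρ, sum_stab_mul_chain, sum_addParticle_pile a (isHarmonic_stab a ξ), idla_eq, hy]
    congr 1
    rw [← hy, Params.exitProb, Finset.sum_mul]
    refine Finset.sum_congr rfl fun z hz => ?_
    have hzy : z = y := by simpa using hz
    have huniv : insert z {y}ᶜ = Finset.univ := by
      rw [hzy, Finset.eq_univ_iff_forall]
      intro x
      by_cases hx : x = y <;> simp [hx]
    rw [huniv, eq_ones_of_pile_univ a (isHarmonic_stab a ξ)]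
    rfl
  have hleft : (ρ - a.stationary) ᵥ* (chain a - (1 - a.gap) • (1 : Matrix _ _ ℝ)) = 0 := by
    funext ξ
    have h1 : ((ρ - a.stationary) ᵥ* chain a) ξ =
        ∑ η, ρ η * chain a η ξ - ∑ η, a.stationary η * chain a η ξ := by
      rw [Matrix.sub_vecMul]
      rfl
    rw [Matrix.vecMul_sub, Matrix.vecMul_smul, Matrix.vecMul_one, Pi.sub_apply, h1, hρP,
      sum_stationary_mul_chain]
    simp only [Pi.smul_apply, Pi.sub_apply, smul_eq_mul, Pi.zero_apply]
    ring
  have hne : ρ - a.stationary ≠ 0 := fun h => by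
    have h1 := congrFun h fullConfig
    have h2 : ρ fullConfig = 0 := by
      refine stab_eq_zero_of_numParticles_lt a ?_
      rw [numParticles_pile_empty]
      have h3 : numParticles (ofStable (fullConfig : V → Bool)) = Fintype.card V := by
        simp [numParticles, ofStable, fullConfig, SiteState.count]
      rw [h3, Finset.card_lt_iff_ne_univ]
      intro h4
      have := Finset.mem_univ y
      rw [← h4] at this
      simp at this
    rw [Pi.sub_apply, h2, Pi.zero_apply] at h1
    linarith [stationary_pos a fullConfig]
  obtain ⟨f, hf, hPf⟩ := Matrix.exists_mulVec_eq_zero_iff.2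
    (Matrix.exists_vecMul_eq_zero_iff.1 ⟨_, hne, hleft⟩)
  refine ⟨f, hf, fun η => ?_⟩
  have h := congrFun hPf η
  rw [Matrix.sub_mulVec, Matrix.smul_mulVec, Matrix.one_mulVec] at h
  simp only [Pi.sub_apply, Pi.smul_apply, smul_eq_mul, Pi.zero_apply] at h
  exact sub_eq_zero.1 h

/-- Spectral lower bound on the total-variation distance. -/
lemma one_sub_gap_pow_le (n : ℕ) : (1 - a.gap) ^ n ≤ 2 * tvDist (chain a) n := by
  obtain ⟨f, hf, hPf⟩ := exists_eigenvector a
  have hpow : ∀ n η, ∑ ξ, (chain a ^ n) η ξ * f ξ = (1 - a.gap) ^ n * f η := fun n => by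
    induction n with
    | zero => intro η; simp [Matrix.one_apply]
    | succ n ih =>
      intro η
      simp only [pow_succ, Matrix.mul_apply, Finset.sum_mul, mul_assoc]
      rw [Finset.sum_comm]
      simp only [← Finset.mul_sum, hPf]
      simp only [mul_left_comm _ (1 - a.gap), ← Finset.mul_sum, ih]
  have hπ : ∑ ξ, a.stationary ξ * f ξ = 0 := by
    have h1 : ∑ ξ, a.stationary ξ * f ξ = (1 - a.gap) * ∑ ξ, a.stationary ξ * f ξ := by
      calc ∑ ξ, a.stationary ξ * f ξ = ∑ ξ, (∑ η, a.stationary η * chain a η ξ) * f ξ := by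
            simp only [sum_stationary_mul_chain]
        _ = ∑ η, a.stationary η * ∑ ξ, chain a η ξ * f ξ := by
            simp only [Finset.sum_mul, Finset.mul_sum]
            rw [Finset.sum_comm]
            simp only [mul_assoc]
        _ = _ := by
            simp only [hPf, mul_left_comm _ (1 - a.gap), ← Finset.mul_sum]
    have h2 : a.gap * ∑ ξ, a.stationary ξ * f ξ = 0 := by linarith
    exact (mul_eq_zero.1 h2).resolve_left (gap_pos a).ne'
  obtain ⟨η, -, hη⟩ := Finset.exists_max_image Finset.univ (fun η => |f η|)
    ⟨emptyConfig, Finset.mem_univ _⟩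
  have hpos : 0 < |f η| := by
    obtain ⟨ζ, hζ⟩ := Function.ne_iff.1 hf
    exact (abs_pos.2 hζ).trans_le (hη ζ (Finset.mem_univ ζ))
  set δ : (V → Bool) → ℝ := fun ξ => (chain a ^ n) η ξ - a.stationary ξ with hδ
  have h1 : (1 - a.gap) ^ n * f η = ∑ ξ, δ ξ * f ξ := by
    simp only [hδ, sub_mul, Finset.sum_sub_distrib, hπ, hpow, sub_zero]
  have h2 : (1 - a.gap) ^ n * |f η| ≤ (∑ ξ, |δ ξ|) * |f η| := by
    have h3 : 0 ≤ (1 - a.gap) ^ n := pow_nonneg (by linarith [gap_le_one a]) n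
    rw [← abs_of_nonneg h3, ← abs_mul, h1, Finset.sum_mul]
    refine (Finset.abs_sum_le_sum_abs _ _).trans (Finset.sum_le_sum fun ξ hξ => ?_)
    rw [abs_mul]
    exact mul_le_mul_of_nonneg_left (hη ξ hξ) (abs_nonneg _)
  refine (le_of_mul_le_mul_right h2 hpos).trans ?_
  set B : Finset (V → Bool) := Finset.univ.filter fun ξ => 0 ≤ δ ξ with hB
  have h4 : ∑ ξ, |δ ξ| = 2 * ∑ ξ ∈ B, δ ξ := by
    have h5 : ∑ ξ ∈ B, δ ξ + ∑ ξ ∈ Bᶜ, δ ξ = 0 := by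
      rw [Finset.sum_add_sum_compl]
      simp only [hδ, Finset.sum_sub_distrib, sum_pow_chain, sum_stationary, sub_self]
    rw [← Finset.sum_add_sum_compl B]
    have h6 : ∑ ξ ∈ B, |δ ξ| = ∑ ξ ∈ B, δ ξ :=
      Finset.sum_congr rfl fun ξ hξ => abs_of_nonneg (Finset.mem_filter.1 hξ).2
    have h7 : ∑ ξ ∈ Bᶜ, |δ ξ| = -∑ ξ ∈ Bᶜ, δ ξ := by
      rw [← Finset.sum_neg_distrib]
      refine Finset.sum_congr rfl fun ξ hξ => abs_of_neg ?_
      simpa [hB] using hξ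
    rw [h6, h7]
    linarith
  rw [h4]
  have h8 : |∑ y ∈ B, (chain a ^ n) η y - ∑ y ∈ B, a.stationary y| ≤ tvDist (chain a) n := by
    unfold tvDist
    rw [invariantDistribution_chain]
    exact le_ciSup (f := fun p : (V → Bool) × Finset (V → Bool) =>
      |∑ y ∈ p.2, (chain a ^ n) p.1 y - ∑ y ∈ p.2, a.stationary y|)
      (Set.finite_range _).bddAbove (η, B)
  have h9 := le_abs_self (∑ y ∈ B, (chain a ^ n) η y - ∑ y ∈ B, a.stationary y)
  simp only [hδ, Finset.sum_sub_distrib]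
  linarith

/-! ### The cutoff phenomenon -/

lemma le_of_mixingTime {d : ℕ → ℝ} {ε : ℝ} (h : ∃ t, d t ≤ ε) : d (mixingTime d ε) ≤ ε :=
  Nat.sInf_mem (s := {t : ℕ | d t ≤ ε}) h

lemma lt_of_lt_mixingTime {d : ℕ → ℝ} {ε : ℝ} {t : ℕ} (h : t < mixingTime d ε) : ε < d t :=
  not_le.1 fun h' => Nat.notMem_of_lt_sInf (s := {t : ℕ | d t ≤ ε}) h h'

lemma mixingTime_le {d : ℕ → ℝ} {ε : ℝ} {t : ℕ} (h : d t ≤ ε) : mixingTime d ε ≤ t :=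
  Nat.sInf_le (s := {t : ℕ | d t ≤ ε}) h

/-- The separation mixing time. -/
def Params.sepTime (a : Params V) : ℕ := mixingTime (sepDist (chain a)) (1 / 2)

lemma sepDist_sepTime_le : sepDist (chain a) a.sepTime ≤ 1 / 2 := by
  refine le_of_mixingTime ?_
  simp only [sepDist_chain]
  exact ((tendsto_unfilled a ∅).eventually_le_const (by norm_num)).exists

lemma mixingTime_tvDist_le : mixingTime (tvDist (chain a)) (1 / 2) ≤ a.sepTime :=
  mixingTime_le ((tvDist_chain_le a _).trans ((sepDist_chain a _).symm.le.trans
    (sepDist_sepTime_le a)))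

lemma sepDist_eq_one {t : ℕ} (ht : t < Fintype.card V) : sepDist (chain a) t = 1 := by
  rw [sepDist_chain]
  exact unfilled_eq_one a (by simpa using ht)

lemma card_le_sepTime : Fintype.card V ≤ a.sepTime := by
  by_contra! h
  have h1 := sepDist_sepTime_le a
  rw [sepDist_eq_one a h] at h1
  norm_num at h1

lemma sepDist_card_le : sepDist (chain a) (Fintype.card V) ≤ Fintype.card V * (1 - a.gap) := by
  rw [sepDist_chain]
  simpa using unfilled_card_le a ∅

lemma sepDist_antitone : Antitone (sepDist (chain a)) := by
  intro s t hst
  rw [sepDist_chain, sepDist_chain]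
  exact unfilled_antitone a ∅ hst

lemma sepDist_nonneg (t : ℕ) : 0 ≤ sepDist (chain a) t := by
  rw [sepDist_chain]
  exact unfilled_nonneg a t ∅

lemma sepDist_le_one (t : ℕ) : sepDist (chain a) t ≤ 1 := by
  rw [sepDist_chain]
  exact unfilled_le_one a t ∅

/-- The product of the spectral gap and the expected filling time. -/
def Params.scale (a : Params V) : ℝ := a.gap * a.fillTime ∅

lemma scale_nonneg : 0 ≤ a.scale := mul_nonneg (gap_pos a).le (fillTime_nonneg a ∅)

lemma sepDist_mul_sq_le {t : ℕ} (ht : a.scale ≤ a.gap * t) :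
    sepDist (chain a) t * (a.gap * t - a.scale) ^ 2 ≤ a.scale := by
  have hg := gap_pos a
  have h := unfilled_mul_sq_le a t (-a.fillTime ∅)
    (by linarith [le_of_mul_le_mul_left ht hg]) ∅
  rw [Params.quad, add_neg_cancel] at h
  rw [sepDist_chain]
  have h2 := mul_le_mul_of_nonneg_left h (sq_nonneg a.gap)
  have h3 : a.gap ^ 2 * (0 ^ 2 + a.fillTime ∅ / a.gap) = a.scale := by
    rw [Params.scale]
    field_simp
    ring
  rw [h3] at h2
  refine le_trans (le_of_eq ?_) h2
  rw [Params.scale]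
  ring

lemma one_sub_sepDist_mul_sq_le {t : ℕ} (ht : a.gap * t ≤ a.scale) :
    (1 - sepDist (chain a) t) * (a.gap * t - a.scale) ^ 2 ≤ a.scale := by
  have hg := gap_pos a
  have h := one_sub_unfilled_mul_sq_le a t (-a.fillTime ∅)
    (by linarith [le_of_mul_le_mul_left ht hg]) ∅
  rw [Params.quad, add_neg_cancel] at h
  rw [sepDist_chain]
  have h2 := mul_le_mul_of_nonneg_left h (sq_nonneg a.gap)
  have h3 : a.gap ^ 2 * (0 ^ 2 + a.fillTime ∅ / a.gap) = a.scale := by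
    rw [Params.scale]
    field_simp
    ring
  rw [h3] at h2
  refine le_trans (le_of_eq ?_) h2
  rw [Params.scale]
  ring

/-- The separation mixing time exceeds the expected filling time by at most a few standard
deviations. The square root is linearized by the inequality of means, with parameter `κ`. -/
lemma gap_mul_sepTime_le {κ : ℝ} (hκ : 0 < κ) :
    a.gap * a.sepTime ≤ a.scale + 1 + (κ * a.scale + 1 / (2 * κ)) := by
  by_contra! h
  have hX := scale_nonneg a
  have hκ' : 0 < 1 / (2 * κ) := by positivity
  have hκX : 0 ≤ κ * a.scale := mul_nonneg hκ.le hX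
  have hg := gap_pos a
  have hg1 := gap_le_one a
  have hs : 1 ≤ a.sepTime := by
    by_contra! h0
    have h0 : a.sepTime = 0 := by omega
    rw [h0, Nat.cast_zero, mul_zero] at h
    linarith
  have hcast : a.gap * ((a.sepTime - 1 : ℕ) : ℝ) = a.gap * a.sepTime - a.gap := by
    rw [Nat.cast_sub hs]
    push_cast
    ring
  have h1 := sepDist_mul_sq_le a (t := a.sepTime - 1) (by rw [hcast]; linarith)
  have h2 : 1 / 2 < sepDist (chain a) (a.sepTime - 1) :=
    lt_of_lt_mixingTime (by change a.sepTime - 1 < a.sepTime; omega)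
  have h3 : κ * a.scale + 1 / (2 * κ) < a.gap * ((a.sepTime - 1 : ℕ) : ℝ) - a.scale := by
    rw [hcast]
    linarith
  have h4 : 2 * a.scale ≤ (κ * a.scale + 1 / (2 * κ)) ^ 2 := by
    have h5 : κ * a.scale * (1 / (2 * κ)) = a.scale / 2 := by field_simp
    nlinarith [sq_nonneg (κ * a.scale - 1 / (2 * κ))]
  have h6 := pow_lt_pow_left₀ h3 (by linarith) two_ne_zero
  nlinarith

/-- The separation mixing time falls short of the expected filling time by at most a few standard
deviations. -/
lemma scale_le_gap_mul_sepTime {κ : ℝ} (hκ : 0 < κ) :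
    a.scale ≤ a.gap * a.sepTime + (κ * a.scale + 1 / (2 * κ)) := by
  by_contra! h
  have hX := scale_nonneg a
  have hκ' : 0 < 1 / (2 * κ) := by positivity
  have hκX : 0 ≤ κ * a.scale := mul_nonneg hκ.le hX
  have h1 := one_sub_sepDist_mul_sq_le a (t := a.sepTime) (by linarith)
  have h2 := sepDist_sepTime_le a
  have h3 : κ * a.scale + 1 / (2 * κ) < a.scale - a.gap * a.sepTime := by linarith
  have h4 : 2 * a.scale ≤ (κ * a.scale + 1 / (2 * κ)) ^ 2 := by
    have h5 : κ * a.scale * (1 / (2 * κ)) = a.scale / 2 := by field_simp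
    nlinarith [sq_nonneg (κ * a.scale - 1 / (2 * κ))]
  have h6 := pow_lt_pow_left₀ h3 (by linarith) two_ne_zero
  nlinarith

/-- Chebyshev's inequality in the form `u * (β X) ^ 2 ≤ X`, for a large scale `X`. -/
lemma le_of_mul_sq_le {u v X β ε : ℝ} (hβ : 0 < β) (hε : 0 < ε) (hX : 1 / (β ^ 2 * ε) ≤ X)
    (hu : 0 ≤ u) (hv : (β * X) ^ 2 ≤ v) (h : u * v ≤ X) : u ≤ ε := by
  by_contra! hlt
  have hX0 : 0 < X := lt_of_lt_of_le (by positivity) hX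
  rw [div_le_iff₀ (by positivity)] at hX
  have h1 : u * (β * X) ^ 2 ≤ X := (mul_le_mul_of_nonneg_left hv hu).trans h
  have h2 : ε * (β * X) ^ 2 < u * (β * X) ^ 2 := mul_lt_mul_of_pos_right hlt (by positivity)
  nlinarith

/-- After the separation mixing time, under the product condition. -/
lemma exists_forall_sepDist_le {α : ℝ} (hα : 1 < α) {ε : ℝ} (hε : 0 < ε) :
    ∃ M : ℝ, ∀ {V : Type*} [Fintype V] [DecidableEq V] (a : Params V),
      M ≤ a.gap * a.sepTime → sepDist (chain a) ⌊α * a.sepTime⌋₊ ≤ ε := by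
  set β : ℝ := (α - 1) / 2 with hβ
  have hβ0 : 0 < β := by linarith
  set κ : ℝ := β / (2 * α) with hκ
  have hκ0 : 0 < κ := by positivity
  set C : ℝ := α * (1 / (2 * κ)) + 1 with hC
  refine ⟨2 * (1 / (β ^ 2 * ε) + 2 * C / β) + 2, fun a hM => ?_⟩
  have h1 := gap_mul_sepTime_le a one_pos
  have h2 := scale_le_gap_mul_sepTime a hκ0
  have hg := gap_pos a
  have hg1 := gap_le_one a
  set X := a.scale
  set Y := a.gap * a.sepTime with hY
  have hC0 : 0 < C := by positivity
  have hp1 : 0 < 1 / (β ^ 2 * ε) := by positivity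
  have hp2 : 0 < 2 * C / β := by positivity
  have hXR : 1 / (β ^ 2 * ε) + 2 * C / β ≤ X := by linarith
  have hX2 : 2 * C ≤ β * X := by
    have : 2 * C / β ≤ X := by linarith
    rw [div_le_iff₀ hβ0] at this
    linarith
  have ht : α * Y - 1 ≤ a.gap * (⌊α * a.sepTime⌋₊ : ℝ) := by
    have h3 := Nat.lt_floor_add_one (α * (a.sepTime : ℝ))
    have h4 : a.gap * (α * a.sepTime) ≤ a.gap * ((⌊α * a.sepTime⌋₊ : ℝ) + 1) :=
      mul_le_mul_of_nonneg_left h3.le hg.le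
    rw [hY]
    nlinarith
  have hακ : α * κ = β / 2 := by
    rw [hκ]
    field_simp
  have h5 : α * X ≤ α * Y + (β / 2 * X + α * (1 / (2 * κ))) := by
    have := mul_le_mul_of_nonneg_left h2 (by linarith : (0 : ℝ) ≤ α)
    rw [← hακ]
    linarith
  have h6 : β * X ≤ a.gap * (⌊α * a.sepTime⌋₊ : ℝ) - X := by
    have h7 : α = 2 * β + 1 := by linarith
    have h8 : α * X = 2 * (β * X) + X := by rw [h7]; ring
    linarith
  have hX0 : 0 ≤ β * X := by linarith
  exact le_of_mul_sq_le hβ0 hε (by linarith) (sepDist_nonneg a _)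
    (pow_le_pow_left₀ hX0 h6 2) (sepDist_mul_sq_le a (by linarith))

/-- Before the separation mixing time, under the product condition. -/
lemma exists_forall_one_sub_sepDist_le {α : ℝ} (hα0 : 0 ≤ α) (hα : α < 1) {ε : ℝ} (hε : 0 < ε) :
    ∃ M : ℝ, ∀ {V : Type*} [Fintype V] [DecidableEq V] (a : Params V),
      M ≤ a.gap * a.sepTime → 1 - sepDist (chain a) ⌊α * a.sepTime⌋₊ ≤ ε := by
  set β : ℝ := (1 - α) / 2 with hβ
  have hβ0 : 0 < β := by linarith
  set κ : ℝ := β / 2 with hκ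
  have hκ0 : 0 < κ := by positivity
  set C : ℝ := 1 / (2 * κ) + 1 with hC
  refine ⟨2 * (1 / (β ^ 2 * ε) + 2 * C / β) + 2, fun a hM => ?_⟩
  have h1 := gap_mul_sepTime_le a one_pos
  have h2 := gap_mul_sepTime_le a hκ0
  have hg := gap_pos a
  set X := a.scale
  set Y := a.gap * a.sepTime with hY
  have hC0 : 0 < C := by positivity
  have hp1 : 0 < 1 / (β ^ 2 * ε) := by positivity
  have hp2 : 0 < 2 * C / β := by positivity
  have hXR : 1 / (β ^ 2 * ε) + 2 * C / β ≤ X := by linarith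
  have hX2 : 2 * C ≤ β * X := by
    have : 2 * C / β ≤ X := by linarith
    rw [div_le_iff₀ hβ0] at this
    linarith
  have ht : a.gap * (⌊α * a.sepTime⌋₊ : ℝ) ≤ α * Y := by
    have h3 := Nat.floor_le (mul_nonneg hα0 (Nat.cast_nonneg a.sepTime))
    have h4 := mul_le_mul_of_nonneg_left h3 hg.le
    rw [hY]
    linarith
  have hX0 : 0 ≤ β * X := by linarith
  have h5 : α * Y ≤ α * X + (β / 2 * X + C) := by
    have h6 : Y ≤ X + (β / 2 * X + C) := by
      have : κ * X = β / 2 * X := rfl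
      linarith
    have h7 := mul_le_mul_of_nonneg_left h6 hα0
    have h8 : α * (β / 2 * X + C) ≤ β / 2 * X + C := mul_le_of_le_one_left (by linarith) hα.le
    linarith
  have h6 : β * X ≤ X - a.gap * (⌊α * a.sepTime⌋₊ : ℝ) := by
    have h7 : α = 1 - 2 * β := by linarith
    have h8 : α * X = X - 2 * (β * X) := by rw [h7]; ring
    linarith
  have h7 := pow_le_pow_left₀ hX0 h6 2
  refine le_of_mul_sq_le hβ0 hε (by linarith) (sub_nonneg.2 (sepDist_le_one a _))
    (h7.trans (le_of_eq ?_)) (one_sub_sepDist_mul_sq_le a (by linarith))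
  ring

/-- If `(1 - g) ^ (2 s)` is small, then either `g s` is large or `g` is so close to `1` that
`s (1 - g)` is small. -/
lemma exists_forall_le_or_le (M : ℝ) {ε : ℝ} (hε : 0 < ε) :
    ∃ δ > 0, ∀ (g : ℝ) (s : ℕ), 0 < g → g ≤ 1 → (1 - g) ^ (2 * s) ≤ δ →
      M ≤ g * s ∨ s * (1 - g) ≤ ε := by
  set k : ℕ := ⌈2 * M⌉₊ + 1 with hk
  have hk0 : (0 : ℝ) < k := by positivity
  refine ⟨min (Real.exp (-(4 * M))) ((ε / k) ^ (2 * k)), by positivity, fun g s hg hg1 h => ?_⟩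
  by_contra! hcon
  obtain ⟨hM, hs⟩ := hcon
  by_cases hg2 : g < 1 / 2
  -- here `log (1 - g) ≥ -2 g`, so that `(1 - g) ^ (2 s) ≥ exp (-4 g s) > exp (-4 M)`
  · have hlog : -(2 * g) ≤ Real.log (1 - g) := by
      refine le_trans ?_ (Real.one_sub_inv_le_log_of_pos (by linarith))
      have : (1 - g)⁻¹ ≤ 1 + 2 * g := by
        rw [inv_le_iff_one_le_mul₀ (by linarith)]
        nlinarith
      linarith
    have h1 : Real.exp (-(2 * g)) ≤ 1 - g := by
      rw [← Real.le_log_iff_exp_le (by linarith)]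
      exact hlog
    have h2 := pow_le_pow_left₀ (Real.exp_pos _).le h1 (2 * s)
    rw [← Real.exp_nat_mul] at h2
    have h3 := h2.trans (h.trans (min_le_left _ _))
    rw [Real.exp_le_exp] at h3
    push_cast at h3
    linarith
  · push Not at hg2
    have hs0 : (0 : ℝ) ≤ s := Nat.cast_nonneg s
    have hsk : s ≤ k := by
      have h1 : (s : ℝ) ≤ 2 * M := by nlinarith
      have h2 : (s : ℝ) ≤ (⌈2 * M⌉₊ : ℝ) := h1.trans (Nat.le_ceil _)
      have h3 : s ≤ ⌈2 * M⌉₊ := by exact_mod_cast h2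
      omega
    have h1 : (1 - g) ^ (2 * k) ≤ (ε / k) ^ (2 * k) :=
      (pow_le_pow_of_le_one (by linarith) (by linarith) (by omega)).trans
        (h.trans (min_le_right _ _))
    have h2 : 1 - g ≤ ε / k := le_of_pow_le_pow_left₀ (by omega) (by positivity) h1
    rw [le_div_iff₀ hk0] at h2
    have h3 : (s : ℝ) * (1 - g) ≤ k * (1 - g) :=
      mul_le_mul_of_nonneg_right (by exact_mod_cast hsk) (by linarith)
    linarith

/-- If all walks visit all sites with high probability, then the separation mixing time is `|V|`. -/
lemma sepTime_eq_card (h : a.sepTime * (1 - a.gap) ≤ 1 / 2) : a.sepTime = Fintype.card V := by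
  refine le_antisymm (mixingTime_le ((sepDist_card_le a).trans (le_trans ?_ h)))
    (card_le_sepTime a)
  exact mul_le_mul_of_nonneg_right (by exact_mod_cast card_le_sepTime a)
    (by linarith [gap_le_one a])

lemma sepDist_floor_le {α : ℝ} (hα : 1 < α) {ε : ℝ} (h : a.sepTime * (1 - a.gap) ≤ 1 / 2)
    (h' : a.sepTime * (1 - a.gap) ≤ ε) : sepDist (chain a) ⌊α * a.sepTime⌋₊ ≤ ε := by
  have hs := sepTime_eq_card a h
  have h1 : Fintype.card V ≤ ⌊α * a.sepTime⌋₊ := by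
    rw [← hs]
    refine Nat.le_floor ?_
    have : (0 : ℝ) ≤ a.sepTime := Nat.cast_nonneg _
    nlinarith
  refine (sepDist_antitone a h1).trans ((sepDist_card_le a).trans ?_)
  rwa [← hs]

lemma card_pos (a : Params V) : 0 < Fintype.card V := by
  by_contra! h
  have := Fintype.card_eq_zero_iff.1 (Nat.le_zero.1 h)
  simpa using a.ν_sum

lemma sepDist_floor_eq_one {α : ℝ} (hα0 : 0 ≤ α) (hα : α < 1)
    (h : a.sepTime * (1 - a.gap) ≤ 1 / 2) : sepDist (chain a) ⌊α * a.sepTime⌋₊ = 1 := by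
  refine sepDist_eq_one a ?_
  rw [sepTime_eq_card a h, Nat.floor_lt (mul_nonneg hα0 (Nat.cast_nonneg _))]
  have : (0 : ℝ) < Fintype.card V := by exact_mod_cast card_pos a
  nlinarith

/-- Total-variation cutoff forces `(1 - gap) ^ (2 * sepTime)` to vanish, by the spectral lower
bound at twice the mixing time. -/
lemma tendsto_one_sub_gap_pow {V : ℕ → Type*} [∀ n, Fintype (V n)] [∀ n, DecidableEq (V n)]
    (a : ∀ n, Params (V n)) (hTV : HasCutoff fun n => tvDist (chain (a n))) :
    Tendsto (fun n => (1 - (a n).gap) ^ (2 * (a n).sepTime)) atTop (𝓝 0) := by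
  have h := ((hTV 2 zero_le_two).2 one_lt_two).const_mul 2
  rw [mul_zero] at h
  refine squeeze_zero (fun n => pow_nonneg (by linarith [gap_le_one (a n)]) _) (fun n => ?_) h
  have hfloor : ∀ m : ℕ, ⌊(2 : ℝ) * m⌋₊ = 2 * m := fun m => by
    have : (2 : ℝ) * m = ((2 * m : ℕ) : ℝ) := by push_cast; ring
    rw [this, Nat.floor_natCast]
  rw [hfloor]
  refine le_trans ?_ (one_sub_gap_pow_le (a n) _)
  have : mixingTime ((fun n => tvDist (chain (a n))) n) (1 / 2) ≤ (a n).sepTime :=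
    mixingTime_tvDist_le (a n)
  exact pow_le_pow_of_le_one (by linarith [gap_le_one (a n)]) (by linarith [gap_pos (a n)])
    (by omega)

end

end ARW

theorem mainTheorem10 {V : ℕ → Type*} [∀ n, Fintype (V n)] [∀ n, DecidableEq (V n)]
    (a : ∀ n, ARW.Params (V n))
    (hTV : ARW.HasCutoff (fun n => ARW.tvDist (ARW.chain (a n)))) :
    ARW.HasCutoff (fun n => ARW.sepDist (ARW.chain (a n))) := by
  have hgap := ARW.tendsto_one_sub_gap_pow a hTV
  have hcase : ∀ M ε : ℝ, 0 < ε → ∀ᶠ n in atTop, M ≤ (a n).gap * (a n).sepTime ∨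
      (a n).sepTime * (1 - (a n).gap) ≤ ε := fun M ε hε => by
    obtain ⟨δ, hδ, h⟩ := ARW.exists_forall_le_or_le M hε
    filter_upwards [hgap.eventually_le_const hδ] with n hn
    exact h _ _ (ARW.gap_pos (a n)) (ARW.gap_le_one (a n)) hn
  intro α hα0
  refine ⟨fun hα => ?_, fun hα => ?_⟩
  · rw [Metric.tendsto_nhds]
    intro ε hε
    obtain ⟨M, hM⟩ := ARW.exists_forall_one_sub_sepDist_le hα0 hα (half_pos hε)
    filter_upwards [hcase M (1 / 2) (by norm_num)] with n hn
    rw [dist_comm, Real.dist_eq, abs_of_nonneg (sub_nonneg.2 (ARW.sepDist_le_one (a n) _))]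
    rcases hn with h | h
    · exact (hM (a n) h).trans_lt (half_lt_self hε)
    · have := ARW.sepDist_floor_eq_one (a n) hα0 hα h
      rw [ARW.Params.sepTime] at this
      rwa [this, sub_self]
  · rw [Metric.tendsto_nhds]
    intro ε hε
    obtain ⟨M, hM⟩ := ARW.exists_forall_sepDist_le hα (half_pos hε)
    filter_upwards [hcase M (min (1 / 2) (ε / 2)) (by positivity)] with n hn
    rw [dist_zero_right, Real.norm_of_nonneg (ARW.sepDist_nonneg (a n) _)]
    refine lt_of_le_of_lt ?_ (half_lt_self hε)
    rcases hn with h | h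
    · exact hM (a n) h
    · exact ARW.sepDist_floor_le (a n) hα (h.trans (min_le_left _ _)) (h.trans (min_le_right _ _))
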